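/- Let $F'/F$ be a field extension and let $\mathcal{A}$ be an $F$-finite $F$-linear abelian category, i.e. every object of $\mathcal{A}$ has finite length and every endomorphism algebra $\mathrm{End}_{\mathcal{A}}(X)$ is finite-dimensional over $F$. Let $\mathrm{ind}\,\mathcal{A}$ be the $F$-linear category of ind-objects of $\mathcal{A}$, whose objects are the filtered direct systems $(X_i)_{i\in I}$ in $\mathcal{A}$, with $\mathrm{Hom}((X_i)_i,(Y_j)_j)=\varprojlim_i\varinjlim_j\mathrm{Hom}_{\mathcal{A}}(X_i,Y_j)$. Let $(\mathrm{ind}\,\mathcal{A})_{F'}$ be the $F'$-linear category of $F'$-modules in $\mathrm{ind}\,\mathcal{A}$: its objects are pairs $(X,\phi)$ of an ind-object $X$ and an $F$-algebra homomorphism $\phi\colon F'\to\mathrm{End}_{\mathrm{ind}\,\mathcal{A}}(X)$, its morphisms are the morphisms of ind-objects that commute with the actions of $F'$. The scalar extension $\mathcal{A}\otimes_F F'$ is the full subcategory of $(\mathrm{ind}\,\mathcal{A})_{F'}$ of objects of finite length. For every object $X$ of $\mathcal{A}$, the ind-object $F'\otimes_F X$ (representing the presheaf $Z\mapsto F'\otimes_F\mathrm{Hom}_{\mathcal{A}}(Z,X)$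 on $\mathcal{A}$, a direct sum of $[F':F]$ copies of $X$), with $F'$ acting by multiplication on the first factor, is an $F'$-module of finite length; this gives a functor $t\colon\mathcal{A}\to\mathcal{A}\otimes_F F'$, $X\mapsto F'\otimes_F X$. Let $\mathcal{B}$ be an $F'$-linear abelian category and let $V\colon\mathcal{A}\to\mathcal{B}$ be a right exact $F$-linear functor. Then: (a) There exist a right exact $F'$-linear functor $V'\colon\mathcal{A}\otimes_F F'\to\mathcal{B}$ and an isomorphism of functors $\alpha\colon V\Rightarrow V'\circ t$. (b) If $(V_1',\alpha_1)$ and $(V_2',\alpha_2)$ both have the property stated in (a), then there exists a unique isomorphism of functors $\beta'\colon V_1'\Rightarrow V_2'$ such that $\alpha_{2,X}=\beta'_{t(X)}\circ\alpha_{1,X}$ for every object $X$ of $\mathcal{A}$. -/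

import Mathlib

open CategoryTheory CategoryTheory.Limits Opposite
open scoped TensorProduct

universe v u w u₀ v₁ u₁

noncomputable section

namespace ScalarExt

/-! ### Objects of finite length and `F`-finite categories -/

/-- An object has finite length if its subobjects satisfy both chain conditions. -/
def HasFiniteLength (C : Type u₁) [Category.{v₁} C] : ObjectProperty C :=
  fun X => IsNoetherianObject X ∧ IsArtinianObject X

/-- An `F`-linear category is `F`-finite if all its objects have finite length and all its
endomorphism algebras are finite-dimensional over `F`. -/
structure IsFiniteOver (F : Type u₀) [Field F] (A : Type u) [Category.{v} A] [Preadditive A]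
    [Linear F A] : Prop where
  hasFiniteLength : ∀ X : A, HasFiniteLength A X
  finite_end : ∀ X : A, Module.Finite F (End X)

/-! ### The category of ind-objects of an `F`-linear category -/

section Ind

variable (F : Type u₀) [Field F] (A : Type u) [Category.{v} A] [Preadditive A] [Linear F A]

/-- A presheaf of `F`-vector spaces on `A` is an ind-object if it is the colimit of a (small)
filtered diagram of representable presheaves. -/
def IsIndObj : ObjectProperty (Aᵒᵖ ⥤ ModuleCat.{v} F) := fun P =>
  ∃ (I : Type v) (_ : SmallCategory I) (_ : IsFiltered I) (D : I ⥤ A)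
    (ι : D ⋙ linearYoneda F A ⟶ (Functor.const I).obj P),
    Nonempty (IsColimit (Cocone.mk P ι))

/-- The `F`-linear category of ind-objects of `A`. A filtered system `(X_i)` is represented by
the presheaf `Z ↦ colim_i Hom(Z, X_i)`; by the (`F`-linear) Yoneda lemma, the morphisms from
`(X_i)` to `(Y_j)` are the elements of `lim_i colim_j Hom(X_i, Y_j)`. -/
abbrev LinInd := (IsIndObj F A).FullSubcategory

end Ind

/-! ### `F'`-modules in an `F`-linear category -/

section FieldModule

variable (F : Type u₀) [Field F] (F' : Type w) [Field F'] [Algebra F F']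
variable (C : Type u₁) [Category.{v₁} C] [Preadditive C] [Linear F C]

/-- An `F'`-module in an `F`-linear category: an object together with an `F`-linear ring
homomorphism from `F'` to its endomorphism algebra. -/
structure FieldModule where
  /-- the underlying object -/
  obj : C
  /-- the action of `F'` -/
  act : F' →ₐ[F] End obj

namespace FieldModule

variable {F F' C}

/-- Homomorphisms of `F'`-modules are the morphisms that commute with the actions of `F'`. -/
@[ext]
structure Hom (X Y : FieldModule F F' C) where
  /-- the underlying morphism -/
  hom : X.obj ⟶ Y.obj
  comm : ∀ a : F', (show X.obj ⟶ X.obj from X.act a) ≫ hom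
    = hom ≫ (show Y.obj ⟶ Y.obj from Y.act a)

instance : Category (FieldModule F F' C) where
  Hom X Y := Hom X Y
  id X := ⟨𝟙 X.obj, fun a => by simp⟩
  comp f g := ⟨f.hom ≫ g.hom, fun a => by
    rw [← Category.assoc, f.comm, Category.assoc, g.comm, Category.assoc]⟩
  id_comp f := Hom.ext (Category.id_comp f.hom)
  comp_id f := Hom.ext (Category.comp_id f.hom)
  assoc f g h := Hom.ext (Category.assoc f.hom g.hom h.hom)

@[ext]
theorem hom_ext {X Y : FieldModule F F' C} {f g : X ⟶ Y} (h : f.hom = g.hom) : f = g :=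
  Hom.ext h

@[simp]
theorem id_hom (X : FieldModule F F' C) : Hom.hom (𝟙 X) = 𝟙 X.obj := rfl

@[simp]
theorem comp_hom {X Y Z : FieldModule F F' C} (f : X ⟶ Y) (g : Y ⟶ Z) :
    (f ≫ g).hom = f.hom ≫ g.hom := rfl

/-- The action of `a : F'`, as a morphism. -/
def actHom (X : FieldModule F F' C) (a : F') : X.obj ⟶ X.obj := X.act a

theorem actHom_comm {X Y : FieldModule F F' C} (f : X ⟶ Y) (a : F') :
    X.actHom a ≫ f.hom = f.hom ≫ Y.actHom a := f.comm a

theorem actHom_one (X : FieldModule F F' C) : X.actHom 1 = 𝟙 X.obj := map_one X.act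

theorem actHom_zero (X : FieldModule F F' C) : X.actHom 0 = 0 := map_zero X.act

theorem actHom_add (X : FieldModule F F' C) (a b : F') :
    X.actHom (a + b) = X.actHom a + X.actHom b := map_add X.act a b

theorem actHom_mul (X : FieldModule F F' C) (a b : F') :
    X.actHom (a * b) = X.actHom b ≫ X.actHom a := map_mul X.act a b

theorem actHom_swap (X : FieldModule F F' C) (a b : F') :
    X.actHom a ≫ X.actHom b = X.actHom b ≫ X.actHom a := by
  rw [← actHom_mul, ← actHom_mul, mul_comm]

variable (X Y : FieldModule F F' C)

instance : Zero (X ⟶ Y) := ⟨⟨0, fun a => by simp⟩⟩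
instance : Add (X ⟶ Y) := ⟨fun f g => ⟨f.hom + g.hom, fun a => by
  rw [Preadditive.comp_add, Preadditive.add_comp, f.comm, g.comm]⟩⟩
instance : Neg (X ⟶ Y) := ⟨fun f => ⟨-f.hom, fun a => by
  rw [Preadditive.comp_neg, Preadditive.neg_comp, f.comm]⟩⟩
instance : Sub (X ⟶ Y) := ⟨fun f g => ⟨f.hom - g.hom, fun a => by
  rw [Preadditive.comp_sub, Preadditive.sub_comp, f.comm, g.comm]⟩⟩
instance : SMul ℕ (X ⟶ Y) := ⟨fun n f => ⟨n • f.hom, fun a => by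
  rw [Preadditive.comp_nsmul, Preadditive.nsmul_comp, f.comm]⟩⟩
instance : SMul ℤ (X ⟶ Y) := ⟨fun n f => ⟨n • f.hom, fun a => by
  rw [Preadditive.comp_zsmul, Preadditive.zsmul_comp, f.comm]⟩⟩
/-- `F'` acts on homomorphisms of `F'`-modules through its action on the target. -/
instance : SMul F' (X ⟶ Y) := ⟨fun a f => ⟨f.hom ≫ Y.actHom a, fun b => by
  change X.actHom b ≫ f.hom ≫ Y.actHom a = (f.hom ≫ Y.actHom a) ≫ Y.actHom b
  rw [← Category.assoc, actHom_comm, Category.assoc, Category.assoc, actHom_swap]⟩⟩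

variable {X Y}

@[simp] theorem zero_hom : Hom.hom (0 : X ⟶ Y) = 0 := rfl
@[simp] theorem add_hom (f g : X ⟶ Y) : (f + g).hom = f.hom + g.hom := rfl
theorem smul_hom (a : F') (f : X ⟶ Y) : (a • f).hom = f.hom ≫ Y.actHom a := rfl

instance : AddCommGroup (X ⟶ Y) :=
  Function.Injective.addCommGroup (fun f : X ⟶ Y => f.hom) (fun _ _ h => Hom.ext h)
    rfl (fun _ _ => rfl) (fun _ => rfl) (fun _ _ => rfl) (fun _ _ => rfl) (fun _ _ => rfl)

instance : Preadditive (FieldModule F F' C) where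
  add_comp _ _ _ f g h := hom_ext (Preadditive.add_comp _ _ _ f.hom g.hom h.hom)
  comp_add _ _ _ f g h := hom_ext (Preadditive.comp_add _ _ _ f.hom g.hom h.hom)

instance : Module F' (X ⟶ Y) where
  one_smul f := hom_ext (by simp [smul_hom, actHom_one])
  mul_smul a b f := hom_ext (by simp [smul_hom, actHom_mul])
  smul_zero a := hom_ext (by simp [smul_hom])
  smul_add a f g := hom_ext (by simp [smul_hom])
  add_smul a b f := hom_ext (by simp [smul_hom, actHom_add])
  zero_smul f := hom_ext (by simp [smul_hom, actHom_zero])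

instance : Linear F' (FieldModule F F' C) where
  smul_comp _ _ _ a f g := hom_ext (by simp [smul_hom, actHom_comm])
  comp_smul _ _ _ f a g := hom_ext (by simp [smul_hom])

end FieldModule

end FieldModule

/-- Abelian categories have finite biproducts. -/
instance hasFiniteBiproducts_of_abelian {A : Type u} [Category.{v} A] [Abelian A] :
    HasFiniteBiproducts A :=
  Abelian.hasFiniteBiproducts

/-! ### The scalar extension of a category and the canonical functor to it -/

section ScalarExtension

variable (F : Type u₀) [Field F] (F' : Type v) [Field F'] [Algebra F F']
variable (A : Type u) [Category.{v} A] [Preadditive A] [Linear F A]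

/-- The category of `F'`-modules in the category of ind-objects of `A`. -/
abbrev IndModule := FieldModule F F' (LinInd F A)

/-- The scalar extension of `A` from `F` to `F'`: the `F'`-linear category of `F'`-modules of
finite length in the category of ind-objects of `A`. -/
abbrev ScalarExtension := (HasFiniteLength (IndModule F F' A)).FullSubcategory

/-- The functor `M ↦ F' ⊗ M` on `F`-vector spaces. -/
def tensorFunctor : ModuleCat.{v} F ⥤ ModuleCat.{v} F where
  obj M := ModuleCat.of F (F' ⊗[F] M)
  map f := ModuleCat.ofHom (f.hom.lTensor F')
  map_id M := by ext : 1; exact LinearMap.lTensor_id F' M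
  map_comp f g := by ext : 1; exact LinearMap.lTensor_comp F' g.hom f.hom

variable {A}

/-- The presheaf `Z ↦ F' ⊗ Hom(Z, X)`, which is the direct sum of `[F' : F]` copies of `X` in the
category of ind-objects. -/
def extPresheaf (X : A) : Aᵒᵖ ⥤ ModuleCat.{v} F :=
  (linearYoneda F A).obj X ⋙ tensorFunctor F F'

/-- Multiplication by `a : F'` on `F' ⊗ X`. -/
def extMul (X : A) (a : F') : extPresheaf F F' X ⟶ extPresheaf F F' X where
  app Z := ModuleCat.ofHom ((LinearMap.mulLeft F a).rTensor (unop Z ⟶ X))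
  naturality Z W f := by
    ext : 1
    exact (LinearMap.rTensor_comp_lTensor _ _ _).trans (LinearMap.lTensor_comp_rTensor _ _ _).symm

theorem end_ext {P : LinInd F A} {f g : End P}
    (h : ∀ Z, ((show P ⟶ P from f).hom.app Z).hom = ((show P ⟶ P from g).hom.app Z).hom) :
    f = g :=
  ObjectProperty.hom_ext _ (NatTrans.ext (funext fun Z => ModuleCat.hom_ext (h Z)))

variable [HasFiniteBiproducts A]

section Basis

variable {κ : Type v} (X : A)

/-- The diagram of the finite direct sums of copies of `X` indexed by subsets of `κ`. -/
def finsetDiagram : Finset κ ⥤ A where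
  obj s := ⨁ fun _ : s => X
  map {s t} h := biproduct.desc fun b => biproduct.ι (fun _ : t => X) ⟨b.1, leOfHom h b.2⟩
  map_id s := by
    refine biproduct.hom_ext' _ _ fun b => ?_
    simp
  map_comp f g := by
    refine biproduct.hom_ext' _ _ fun b => ?_
    simp

/-- The projections from a finite direct sum of copies of `X`. -/
def copyπ (s : Finset κ) (i : s) : (finsetDiagram X).obj s ⟶ X := biproduct.π (fun _ : s => X) i

theorem copy_hom_ext {s : Finset κ} {Z : A} {f g : Z ⟶ (finsetDiagram X).obj s}
    (h : ∀ i, f ≫ copyπ X s i = g ≫ copyπ X s i) : f = g :=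
  biproduct.hom_ext _ _ h

theorem copy_exists_lift {s : Finset κ} {Z : A} (c : s → (Z ⟶ X)) :
    ∃ f : Z ⟶ (finsetDiagram X).obj s, ∀ i, f ≫ copyπ X s i = c i :=
  ⟨biproduct.lift c, fun i => biproduct.lift_π c i⟩

theorem map_copyπ_of_mem {s t : Finset κ} (h : s ⟶ t) (i : κ) (hs : i ∈ s) (ht : i ∈ t) :
    (finsetDiagram X).map h ≫ copyπ X t ⟨i, ht⟩ = copyπ X s ⟨i, hs⟩ := by
  classical
  refine biproduct.hom_ext' _ _ fun c => ?_
  simp [finsetDiagram, copyπ, biproduct.ι_π, Subtype.ext_iff]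

theorem map_copyπ_of_notMem {s t : Finset κ} (h : s ⟶ t) (i : κ) (hs : i ∉ s) (ht : i ∈ t) :
    (finsetDiagram X).map h ≫ copyπ X t ⟨i, ht⟩ = 0 := by
  classical
  refine biproduct.hom_ext' _ _ fun c => ?_
  have : (c : κ) ≠ i := fun e => hs (e ▸ c.2)
  simp only [finsetDiagram, copyπ, biproduct.ι_desc_assoc]
  rw [biproduct.ι_π_ne _ (fun e => this (congrArg Subtype.val e))]
  exact comp_zero.symm

variable {F F'} (b : Module.Basis κ F F')

/-- The `F`-linear map `Hom(Z, ⨁_s X) → F' ⊗ Hom(Z, X)`, `f ↦ ∑ i ∈ s, b i ⊗ (i-th component)`. -/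
def finsetMap (s : Finset κ) (Z : A) :
    (Z ⟶ (finsetDiagram X).obj s) →ₗ[F] F' ⊗[F] (Z ⟶ X) :=
  ∑ i : s, (TensorProduct.mk F F' (Z ⟶ X) (b i)).comp (Linear.rightComp F Z (copyπ X s i))

theorem finsetMap_apply (s : Finset κ) (Z : A) (f : Z ⟶ (finsetDiagram X).obj s) :
    finsetMap X b s Z f = ∑ i : s, b i ⊗ₜ[F] (f ≫ copyπ X s i) := by
  rw [finsetMap, LinearMap.sum_apply]
  rfl

theorem finsetMap_precomp (s : Finset κ) {W Z : A} (g : W ⟶ Z) (f : Z ⟶ (finsetDiagram X).obj s) :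
    finsetMap X b s W (g ≫ f) = (Linear.leftComp F X g).lTensor F' (finsetMap X b s Z f) := by
  rw [finsetMap_apply, finsetMap_apply, map_sum]
  refine Finset.sum_congr rfl fun i _ => ?_
  rw [Category.assoc]
  rfl

theorem finsetMap_comp_map {s t : Finset κ} (h : s ⟶ t) (Z : A)
    (f : Z ⟶ (finsetDiagram X).obj s) :
    finsetMap X b t Z (f ≫ (finsetDiagram X).map h) = finsetMap X b s Z f := by
  classical
  rw [finsetMap_apply, finsetMap_apply]
  have hst : s ⊆ t := leOfHom h
  let g : κ → F' ⊗[F] (Z ⟶ X) := fun i =>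
    if hi : i ∈ s then b i ⊗ₜ[F] (f ≫ copyπ X s ⟨i, hi⟩) else 0
  have h1 : ∀ i : t, b i ⊗ₜ[F] ((f ≫ (finsetDiagram X).map h) ≫ copyπ X t i) = g i := by
    rintro ⟨i, hi⟩
    rw [Category.assoc]
    by_cases his : i ∈ s
    · rw [map_copyπ_of_mem X h i his hi]
      simp [g, his]
    · rw [map_copyπ_of_notMem X h i his hi]
      simp [g, his]
  have h2 : ∀ i : s, b i ⊗ₜ[F] (f ≫ copyπ X s i) = g i := by
    rintro ⟨i, hi⟩
    simp [g, hi]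
  rw [Finset.sum_congr rfl fun i _ => h1 i, Finset.sum_congr rfl fun i _ => h2 i,
    Finset.sum_coe_sort t g, Finset.sum_coe_sort s g]
  refine (Finset.sum_subset hst fun i _ hi => ?_).symm
  simp [g, hi]

theorem finsetMap_injective (s : Finset κ) (Z : A) : Function.Injective (finsetMap X b s Z) := by
  classical
  intro f g hfg
  refine copy_hom_ext X fun i => ?_
  have key : ∀ f : Z ⟶ (finsetDiagram X).obj s,
      TensorProduct.equivFinsuppOfBasisLeft b (finsetMap X b s Z f) i = f ≫ copyπ X s i := by
    intro f
    rw [finsetMap_apply, map_sum, Finsupp.finsetSum_apply, Finset.sum_eq_single i]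
    · simp
    · intro j _ hj
      have : (j : κ) ≠ i := fun e => hj (Subtype.ext e)
      simp [this]
    · simp
  rw [← key f, ← key g, hfg]

theorem finsetMap_surjective (Z : A) (x : F' ⊗[F] (Z ⟶ X)) :
    ∃ (s : Finset κ) (f : Z ⟶ (finsetDiagram X).obj s), x = finsetMap X b s Z f := by
  classical
  obtain ⟨c, rfl⟩ := TensorProduct.eq_repr_basis_left b x
  obtain ⟨f, hf⟩ := copy_exists_lift X (s := c.support) fun i => c i
  refine ⟨c.support, f, ?_⟩
  rw [finsetMap_apply]
  simp only [hf]
  exact (Finset.sum_coe_sort c.support fun i => b i ⊗ₜ[F] c i).symm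

/-- The cocone exhibiting `F' ⊗ X` as the union of the finite direct sums of copies of `X`. -/
def finsetCocone :
    finsetDiagram (κ := κ) X ⋙ linearYoneda F A ⟶
      (Functor.const (Finset κ)).obj (extPresheaf F F' X) where
  app s :=
    { app := fun Z => ModuleCat.ofHom (finsetMap X b s (unop Z))
      naturality := by
        intro Z W g
        ext f
        exact finsetMap_precomp X b s g.unop f }
  naturality := by
    intro s t h
    ext Z f
    exact finsetMap_comp_map X b h (unop Z) f

/-- The cocone is a colimit. -/
theorem nonempty_isColimit_finsetCocone :
    Nonempty (IsColimit (Cocone.mk (extPresheaf F F' X) (finsetCocone X b))) := by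
  classical
  refine ⟨evaluationJointlyReflectsColimits _ fun Z => ?_⟩
  have h₁ : ReflectsColimitsOfShape (Finset κ) (forget₂ (ModuleCat.{v} F) AddCommGrpCat.{v}) :=
    reflectsColimitsOfShape_of_reflectsIsomorphisms
  have h₂ : ReflectsColimitsOfShape (Finset κ) (forget AddCommGrpCat.{v}) :=
    reflectsColimitsOfShape_of_reflectsIsomorphisms
  refine isColimitOfReflects (forget₂ (ModuleCat.{v} F) AddCommGrpCat.{v}) ?_
  refine isColimitOfReflects (forget AddCommGrpCat.{v}) ?_
  refine Types.FilteredColimit.isColimitOf'.{v, v} _ _ ?_ ?_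
  · intro x
    exact finsetMap_surjective X b (unop Z) x
  · intro s f g h
    exact ⟨s, 𝟙 s, congrArg _ (finsetMap_injective X b s (unop Z) h)⟩

end Basis

theorem isIndObj_extPresheaf (X : A) : IsIndObj F A (extPresheaf F F' X) :=
  ⟨Finset (Module.Basis.ofVectorSpaceIndex F F'), inferInstance, inferInstance,
    finsetDiagram X, finsetCocone X (Module.Basis.ofVectorSpace F F'),
    nonempty_isColimit_finsetCocone X (Module.Basis.ofVectorSpace F F')⟩

variable (A) in
/-- The functor `X ↦ F' ⊗ X` from `A` to the category of `F'`-modules in the category of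
ind-objects of `A`, where `F'` acts by multiplication on the first factor. -/
def tInd : A ⥤ IndModule F F' A where
  obj X :=
    { obj := ⟨extPresheaf F F' X, isIndObj_extPresheaf F F' X⟩
      act := AlgHom.ofLinearMap
        { toFun := fun a => ObjectProperty.homMk (extMul F F' X a)
          map_add' := fun a b => by
            refine end_ext F fun Z => ?_
            change (LinearMap.mulLeft F (a + b)).rTensor _
              = (LinearMap.mulLeft F a).rTensor _ + (LinearMap.mulLeft F b).rTensor _
            rw [← LinearMap.rTensor_add]
            congr 1
            ext
            simp [add_mul]
          map_smul' := fun r a => by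
            refine end_ext F fun Z => ?_
            change (LinearMap.mulLeft F (r • a)).rTensor _
              = r • (LinearMap.mulLeft F a).rTensor _
            rw [← LinearMap.rTensor_smul]
            congr 1
            ext
            simp }
        (by
          refine end_ext F fun Z => ?_
          change (LinearMap.mulLeft F (1 : F')).rTensor _ = LinearMap.id
          rw [LinearMap.mulLeft_one, LinearMap.rTensor_id])
        (fun a b => by
          refine end_ext F fun Z => ?_
          change (LinearMap.mulLeft F (a * b)).rTensor _
            = (LinearMap.mulLeft F a).rTensor _ ∘ₗ (LinearMap.mulLeft F b).rTensor _
          rw [LinearMap.mulLeft_mul, LinearMap.rTensor_comp]) }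
  map f :=
    { hom := ObjectProperty.homMk
        (Functor.whiskerRight ((linearYoneda F A).map f) (tensorFunctor F F'))
      comm := fun a => by
        ext Z : 4
        exact (LinearMap.lTensor_comp_rTensor _ _ _).trans
          (LinearMap.rTensor_comp_lTensor _ _ _).symm }
  map_id X := by
    ext : 2
    change Functor.whiskerRight ((linearYoneda F A).map (𝟙 X)) (tensorFunctor F F') = 𝟙 _
    rw [CategoryTheory.Functor.map_id, Functor.whiskerRight_id']
  map_comp f g := by
    ext : 2
    change Functor.whiskerRight ((linearYoneda F A).map (f ≫ g)) (tensorFunctor F F')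
      = Functor.whiskerRight ((linearYoneda F A).map f) (tensorFunctor F F')
        ≫ Functor.whiskerRight ((linearYoneda F A).map g) (tensorFunctor F F')
    rw [CategoryTheory.Functor.map_comp, Functor.whiskerRight_comp]

variable {F F'} in
/-- The scalar extension functor `t : A ⥤ A ⊗ F'`, `X ↦ F' ⊗ X`, given that the `F'`-modules
`F' ⊗ X` have finite length. -/
def scalarExtensionFunctor (ht : ∀ X : A, HasFiniteLength _ ((tInd F F' A).obj X)) :
    A ⥤ ScalarExtension F F' A :=
  ObjectProperty.lift _ (tInd F F' A) ht

end ScalarExtension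

/-! ### Linear functors along a field extension -/

/-- A functor from an `F`-linear category to an `F'`-linear category is `F`-linear if it is so for
the `F`-linear structure on the target obtained by restricting scalars along `F → F'`. For
`F = F'` this is the usual notion. -/
structure IsLinearFunctor (F : Type u₀) [Field F] (F' : Type w) [Field F'] [Algebra F F']
    {C : Type u} [Category.{v} C] [Preadditive C] [Linear F C]
    {D : Type u₁} [Category.{v₁} D] [Preadditive D] [Linear F' D] (V : C ⥤ D) : Prop where
  map_add : ∀ {X Y : C} (f g : X ⟶ Y), V.map (f + g) = V.map f + V.map g
  map_smul : ∀ {X Y : C} (a : F) (f : X ⟶ Y), V.map (a • f) = algebraMap F F' a • V.map f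

end ScalarExt

end

/-!
The proof works with presheaves. An `F'`-module `M` in the category of ind-objects of `A` is a
presheaf `Z ↦ M(Z)` of `F'`-vector spaces on `A`, and such presheaves are left exact
(`Presentation.isLeftExact`): sections descend along epimorphisms of `A`. So they behave like
sheaves for the topology generated by the epimorphisms. The place of sub-sheaves is taken by closed
subpresheaves (`ClosedSub`), the place of epimorphisms by locally surjective morphisms, and
morphisms to a left exact presheaf descend along the latter (`exists_desc`). Closed subpresheaves
and quotients of ind-objects are ind-objects (`Presentation.sub`, `exists_quotient`) because the
objects of `A` are noetherian. Hence finite length of `M` amounts to the two chain conditions for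
closed subpresheaves.

The presheaf `F' ⊗ X` is free on the universal section `1 ⊗ 𝟙 X`: morphisms from it to `R` are the
elements of `R(X)`. If `X` is simple, its closed subpresheaves are determined by their sections over
`X`, a subspace of the finite-dimensional space `F' ⊗ End X`; the chain conditions for general `X`
follow by extension (`hasChainConditions_tPsh`). The ascending chain condition shows that every
`M` of finite length is generated by one section, and so is the kernel of the resulting morphism
`F' ⊗ X₀ ⟶ M`; this gives a presentation `F' ⊗ X₁ ⟶ F' ⊗ X₀ ⟶ M ⟶ 0`.

For `b` in `B`, right exactness of `V` makes `homPsh b : Z ↦ Hom(V Z, b)` a left exact presheaf. The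
value `V' M` of the extension is the object that represents `b ↦ Hom(M, homPsh b)`; it is the
cokernel of a morphism `V X₁ ⟶ V X₀` read off from a presentation (`exists_isUniversal`).
Functoriality, linearity and the isomorphism `V ≅ t ⋙ V'` follow from the universal property. For
right exactness it must be seen that a finite colimit in the scalar extension is still universal for
morphisms to `homPsh b`, which does not belong to the scalar extension: a compatible family of
morphisms to a left exact presheaf takes values in the image of some `F' ⊗ X`, which is an object of
finite length (`exists_colimit_desc`).

For uniqueness, a right exact extension `(V', α)` yields morphisms `M ⟶ homPsh (V' M)` that send a
section `x` over `Z` to the composition of `α` with `V'` of the morphism `F' ⊗ Z ⟶ M` given by `x`.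
They are universal because `V'` preserves the cokernel presentation of `M`
(`isUniversal_extensionFamily`), and representing objects are unique up to unique isomorphism.
-/

noncomputable section

namespace ScalarExt

universe w₁ w₂ w₃

/-! ### Linear presheaves, left exactness, and closed subpresheaves -/

section LinPresheaf

/-- A presheaf of `k`-vector spaces on `A` that is `F`-linear for the `F`-linear structure on `A`
and the inclusion of `F` in `k`. The vector spaces may lie in any universe, so that the
presheaves `Z ↦ Hom(V Z, b)` with values in another category are included. -/
structure LinPresheaf (F : Type u₀) [Field F] (k : Type w) [Field k] [Algebra F k]
    (A : Type u) [Category.{v} A] [Preadditive A] [Linear F A] where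
  /-- the space of sections over an object -/
  sec : A → Type w₁
  [addCommGroup : ∀ Z, AddCommGroup (sec Z)]
  [module : ∀ Z, Module k (sec Z)]
  /-- the restriction maps -/
  res : ∀ {Z' Z : A}, (Z' ⟶ Z) → (sec Z →ₗ[k] sec Z')
  res_id : ∀ {Z : A} (x : sec Z), res (𝟙 Z) x = x
  res_comp : ∀ {Z'' Z' Z : A} (f : Z'' ⟶ Z') (g : Z' ⟶ Z) (x : sec Z),
    res (f ≫ g) x = res f (res g x)
  res_add : ∀ {Z' Z : A} (f g : Z' ⟶ Z) (x : sec Z), res (f + g) x = res f x + res g x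
  res_smul : ∀ {Z' Z : A} (r : F) (f : Z' ⟶ Z) (x : sec Z),
    res (r • f) x = algebraMap F k r • res f x

namespace LinPresheaf

attribute [instance] addCommGroup module

variable {F : Type u₀} [Field F] {k : Type w} [Field k] [Algebra F k]

section Preadditive

variable {A : Type u} [Category.{v} A] [Preadditive A] [Linear F A]

theorem res_zero (P : LinPresheaf.{v, u, w, u₀, w₁} F k A) {Z' Z : A} (x : P.sec Z) :
    P.res (0 : Z' ⟶ Z) x = 0 := by
  simpa using P.res_smul (0 : F) (0 : Z' ⟶ Z) x

theorem res_sum (P : LinPresheaf.{v, u, w, u₀, w₁} F k A) {Z' Z : A} {ι : Type*} (s : Finset ι)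
    (f : ι → (Z' ⟶ Z)) (x : P.sec Z) : P.res (∑ i ∈ s, f i) x = ∑ i ∈ s, P.res (f i) x := by
  classical
  induction s using Finset.induction_on with
  | empty => simpa using P.res_zero x
  | insert i s hi ih => rw [Finset.sum_insert hi, Finset.sum_insert hi, res_add, ih]

/-- Morphisms of linear presheaves. -/
@[ext]
structure Hom (P : LinPresheaf.{v, u, w, u₀, w₁} F k A)
    (Q : LinPresheaf.{v, u, w, u₀, w₂} F k A) where
  /-- the component at an object -/
  app : ∀ Z : A, P.sec Z →ₗ[k] Q.sec Z
  naturality : ∀ {Z' Z : A} (f : Z' ⟶ Z) (x : P.sec Z),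
    app Z' (P.res f x) = Q.res f (app Z x)

variable {P : LinPresheaf.{v, u, w, u₀, w₁} F k A} {Q : LinPresheaf.{v, u, w, u₀, w₂} F k A}
  {R : LinPresheaf.{v, u, w, u₀, w₃} F k A}

/-- Composition of morphisms. -/
def Hom.comp (φ : Hom P Q) (ψ : Hom Q R) : Hom P R :=
  ⟨fun Z => (ψ.app Z).comp (φ.app Z), fun f x => by simp [φ.naturality, ψ.naturality]⟩

@[simp] theorem Hom.comp_app (φ : Hom P Q) (ψ : Hom Q R) {Z : A} (x : P.sec Z) :
    (φ.comp ψ).app Z x = ψ.app Z (φ.app Z x) := rfl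

theorem Hom.ext' {φ ψ : Hom P Q} (h : ∀ Z x, φ.app Z x = ψ.app Z x) : φ = ψ :=
  Hom.ext (funext fun Z => LinearMap.ext (h Z))

/-- Sections are determined by their restrictions along epimorphisms. -/
def IsSeparated (P : LinPresheaf.{v, u, w, u₀, w₁} F k A) : Prop :=
  ∀ {Z' Z : A} (e : Z' ⟶ Z) [Epi e] (x : P.sec Z), P.res e x = 0 → x = 0

/-- A morphism is locally surjective if every section of the target lifts after restriction
along an epimorphism. -/
def Hom.LocallySurjective (φ : Hom P Q) : Prop :=
  ∀ (Z : A) (y : Q.sec Z), ∃ (Z' : A) (e : Z' ⟶ Z) (_ : Epi e) (x : P.sec Z'),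
    φ.app Z' x = Q.res e y

/-- Locally surjective morphisms are epimorphic with respect to separated presheaves. -/
theorem IsSeparated.hom_ext (hR : R.IsSeparated) {φ : Hom P Q} (hφ : φ.LocallySurjective)
    {g h : Hom Q R} (hgh : ∀ Z x, g.app Z (φ.app Z x) = h.app Z (φ.app Z x)) : g = h := by
  refine Hom.ext' fun Z y => ?_
  obtain ⟨Z', e, _, x, hx⟩ := hφ Z y
  refine sub_eq_zero.1 (hR e _ ?_)
  rw [map_sub, ← g.naturality, ← h.naturality, ← hx, hgh, sub_self]

end Preadditive

variable {A : Type u} [Category.{v} A] [Abelian A] [Linear F A]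
variable {P : LinPresheaf.{v, u, w, u₀, w₁} F k A} {Q : LinPresheaf.{v, u, w, u₀, w₂} F k A}
  {R : LinPresheaf.{v, u, w, u₀, w₃} F k A}

/-- A linear presheaf is left exact if it turns every short exact sequence
`0 ⟶ kernel e ⟶ Z' ⟶ Z ⟶ 0` into a left exact one. -/
structure IsLeftExact (P : LinPresheaf.{v, u, w, u₀, w₁} F k A) : Prop where
  separated : P.IsSeparated
  exists_res_eq : ∀ {Z' Z : A} (e : Z' ⟶ Z) [Epi e] (x : P.sec Z'),
    P.res (kernel.ι e) x = 0 → ∃ y, P.res e y = x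

/-- Any two epimorphisms to an object are refined by a third one. -/
theorem exists_common_refinement {Z₁ Z₂ Z : A} (e₁ : Z₁ ⟶ Z) (e₂ : Z₂ ⟶ Z) [Epi e₂] :
    ∃ (Z' : A) (p₁ : Z' ⟶ Z₁) (p₂ : Z' ⟶ Z₂), Epi p₁ ∧ p₁ ≫ e₁ = p₂ ≫ e₂ :=
  ⟨pullback e₁ e₂, pullback.fst _ _, pullback.snd _ _, inferInstance, pullback.condition⟩

/-- Morphisms to a left exact presheaf that kill the kernel of a locally surjective morphism `φ`
factor through `φ`: the value at a section is found by descent from a local lift. -/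
theorem exists_desc (hR : R.IsLeftExact) (φ : Hom P Q) (hφ : φ.LocallySurjective) (g : Hom P R)
    (hg : ∀ (Z : A) (x : P.sec Z), φ.app Z x = 0 → g.app Z x = 0) :
    ∃ h : Hom Q R, φ.comp h = g := by
  let rel : ∀ Z : A, Q.sec Z → R.sec Z → Prop := fun Z q n =>
    ∃ (Z' : A) (e : Z' ⟶ Z) (_ : Epi e) (x : P.sec Z'), φ.app Z' x = Q.res e q ∧
      g.app Z' x = R.res e n
  have rel_total : ∀ Z q, ∃ n, rel Z q n := by
    intro Z q
    obtain ⟨Z', e, _, x, hx⟩ := hφ Z q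
    obtain ⟨n, hn⟩ := hR.exists_res_eq e (g.app Z' x) (by
      rw [← g.naturality]
      refine hg _ _ ?_
      rw [φ.naturality, hx, ← Q.res_comp, kernel.condition, Q.res_zero])
    exact ⟨n, Z', e, inferInstance, x, hx, hn.symm⟩
  have rel_unique : ∀ Z n, rel Z 0 n → n = 0 := by
    rintro Z n ⟨Z', e, _, x, hx, hn⟩
    refine hR.separated e n ?_
    rw [← hn]
    exact hg _ _ (by rw [hx, map_zero])
  have rel_add : ∀ Z q n q' n', rel Z q n → rel Z q' n' → rel Z (q + q') (n + n') := by
    rintro Z q n q' n' ⟨Z₁, e₁, _, x, hx, hn⟩ ⟨Z₂, e₂, _, x', hx', hn'⟩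
    obtain ⟨Z', p₁, p₂, _, hp⟩ := exists_common_refinement e₁ e₂
    refine ⟨Z', p₁ ≫ e₁, epi_comp _ _, P.res p₁ x + P.res p₂ x', ?_, ?_⟩
    · rw [map_add, φ.naturality, φ.naturality, hx, hx', ← Q.res_comp, ← Q.res_comp, ← hp, map_add]
    · rw [map_add, g.naturality, g.naturality, hn, hn', ← R.res_comp, ← R.res_comp, ← hp, map_add]
  have rel_smul : ∀ Z q n (a : k), rel Z q n → rel Z (a • q) (a • n) := by
    rintro Z q n a ⟨Z', e, _, x, hx, hn⟩
    exact ⟨Z', e, inferInstance, a • x, by simp [hx], by simp [hn]⟩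
  have rel_res : ∀ Z Z' q n (f : Z' ⟶ Z), rel Z q n → rel Z' (Q.res f q) (R.res f n) := by
    rintro Z Z' q n f ⟨Z₁, e, _, x, hx, hn⟩
    obtain ⟨Z₂, p₁, p₂, _, hp⟩ := exists_common_refinement f e
    refine ⟨Z₂, p₁, inferInstance, P.res p₂ x, ?_, ?_⟩
    · rw [φ.naturality, hx, ← Q.res_comp, ← Q.res_comp, hp]
    · rw [g.naturality, hn, ← R.res_comp, ← R.res_comp, hp]
  have rel_eq : ∀ Z q n n', rel Z q n → rel Z q n' → n = n' := by
    intro Z q n n' h h'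
    refine sub_eq_zero.1 (rel_unique Z _ ?_)
    have := rel_add Z _ _ _ _ h (rel_smul Z _ _ (-1) h')
    rwa [neg_one_smul, neg_one_smul, ← sub_eq_add_neg, ← sub_eq_add_neg, sub_self] at this
  choose f hf using rel_total
  refine ⟨⟨fun Z => ⟨⟨f Z, fun q q' => ?_⟩, fun a q => ?_⟩, fun r q => ?_⟩, ?_⟩
  · exact rel_eq _ _ _ _ (hf Z _) (rel_add _ _ _ _ _ (hf Z q) (hf Z q'))
  · exact rel_eq _ _ _ _ (hf Z _) (rel_smul _ _ _ a (hf Z q))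
  · exact rel_eq _ _ _ _ (hf _ _) (rel_res _ _ _ _ r (hf _ q))
  · refine Hom.ext' fun Z x => rel_eq _ _ _ _ (hf Z (φ.app Z x)) ⟨Z, 𝟙 Z, inferInstance, x, ?_, ?_⟩
    · rw [Q.res_id]
    · rw [R.res_id]

/-- A closed subpresheaf of a linear presheaf: a subpresheaf of subspaces that contains a section
as soon as it contains its restriction along some epimorphism. -/
@[ext]
structure ClosedSub (P : LinPresheaf.{v, u, w, u₀, w₁} F k A) where
  /-- the sections of the subpresheaf -/
  carrier : ∀ Z : A, Submodule k (P.sec Z)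
  res_mem : ∀ {Z' Z : A} (f : Z' ⟶ Z) {x : P.sec Z}, x ∈ carrier Z → P.res f x ∈ carrier Z'
  of_res_mem : ∀ {Z' Z : A} (e : Z' ⟶ Z) [Epi e] {x : P.sec Z}, P.res e x ∈ carrier Z' →
    x ∈ carrier Z

namespace ClosedSub

instance : PartialOrder (ClosedSub P) :=
  PartialOrder.lift (fun S => S.carrier) fun _ _ h => ClosedSub.ext h

theorem le_def {S T : ClosedSub P} : S ≤ T ↔ ∀ Z, ∀ x ∈ S.carrier Z, x ∈ T.carrier Z :=
  Iff.rfl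

instance : OrderTop (ClosedSub P) where
  top := ⟨fun _ => ⊤, fun _ _ _ => trivial, fun _ _ _ _ => trivial⟩
  le_top _ := le_def.2 fun _ _ _ => trivial

@[simp] theorem mem_top {Z : A} (x : P.sec Z) : x ∈ (⊤ : ClosedSub P).carrier Z := trivial

/-- The inverse image of a closed subpresheaf. -/
def comap (φ : Hom P Q) (S : ClosedSub Q) : ClosedSub P where
  carrier Z := (S.carrier Z).comap (φ.app Z)
  res_mem f x hx := by
    rw [Submodule.mem_comap, φ.naturality]
    exact S.res_mem f hx
  of_res_mem e _ x hx := by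
    rw [Submodule.mem_comap, φ.naturality] at hx
    exact S.of_res_mem e hx

@[simp] theorem mem_comap (φ : Hom P Q) (S : ClosedSub Q) {Z : A} (x : P.sec Z) :
    x ∈ (comap φ S).carrier Z ↔ φ.app Z x ∈ S.carrier Z := Iff.rfl

/-- The locus where two morphisms to a separated presheaf agree. -/
def eqLocus (hQ : Q.IsSeparated) (φ ψ : Hom P Q) : ClosedSub P where
  carrier Z := LinearMap.eqLocus (φ.app Z) (ψ.app Z)
  res_mem f x hx := by
    rw [LinearMap.mem_eqLocus] at hx ⊢
    rw [φ.naturality, ψ.naturality, hx]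
  of_res_mem e _ x hx := by
    rw [LinearMap.mem_eqLocus] at hx ⊢
    rw [φ.naturality, ψ.naturality] at hx
    exact sub_eq_zero.1 (hQ e _ (by rw [map_sub, hx, sub_self]))

@[simp] theorem mem_eqLocus (hQ : Q.IsSeparated) (φ ψ : Hom P Q) {Z : A} (x : P.sec Z) :
    x ∈ (eqLocus hQ φ ψ).carrier Z ↔ φ.app Z x = ψ.app Z x := Iff.rfl

/-- The kernel of a morphism to a separated presheaf. -/
def ker (hQ : Q.IsSeparated) (φ : Hom P Q) : ClosedSub P where
  carrier Z := LinearMap.ker (φ.app Z)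
  res_mem f x hx := by
    rw [LinearMap.mem_ker] at hx ⊢
    rw [φ.naturality, hx, map_zero]
  of_res_mem e _ x hx := by
    rw [LinearMap.mem_ker] at hx ⊢
    rw [φ.naturality] at hx
    exact hQ e _ hx

@[simp] theorem mem_ker (hQ : Q.IsSeparated) (φ : Hom P Q) {Z : A} (x : P.sec Z) :
    x ∈ (ker hQ φ).carrier Z ↔ φ.app Z x = 0 := Iff.rfl

/-- The closed image of a closed subpresheaf: the sections that lift to it locally. -/
def map (φ : Hom P Q) (S : ClosedSub P) : ClosedSub Q where
  carrier Z :=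
    { carrier := {y | ∃ (Z' : A) (e : Z' ⟶ Z) (_ : Epi e), ∃ x ∈ S.carrier Z',
        φ.app Z' x = Q.res e y}
      zero_mem' := ⟨Z, 𝟙 Z, inferInstance, 0, zero_mem _, by simp⟩
      add_mem' := by
        rintro y y' ⟨Z₁, e₁, _, x, hxS, hx⟩ ⟨Z₂, e₂, _, x', hxS', hx'⟩
        obtain ⟨Z', p₁, p₂, _, hp⟩ := exists_common_refinement e₁ e₂
        refine ⟨Z', p₁ ≫ e₁, epi_comp _ _, P.res p₁ x + P.res p₂ x',
          add_mem (S.res_mem _ hxS) (S.res_mem _ hxS'), ?_⟩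
        rw [map_add, φ.naturality, φ.naturality, hx, hx', ← Q.res_comp, ← Q.res_comp, ← hp,
          map_add]
      smul_mem' := by
        rintro a y ⟨Z', e, he, x, hxS, hx⟩
        exact ⟨Z', e, he, a • x, Submodule.smul_mem _ _ hxS, by simp [hx]⟩ }
  res_mem := by
    rintro Z' Z f y ⟨Z₁, e, _, x, hxS, hx⟩
    obtain ⟨Z₂, p₁, p₂, _, hp⟩ := exists_common_refinement f e
    refine ⟨Z₂, p₁, inferInstance, P.res p₂ x, S.res_mem _ hxS, ?_⟩
    rw [φ.naturality, hx, ← Q.res_comp, ← Q.res_comp, hp]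
  of_res_mem := by
    rintro Z' Z f _ y ⟨Z₁, e, _, x, hxS, hx⟩
    exact ⟨Z₁, e ≫ f, epi_comp _ _, x, hxS, by rw [hx, Q.res_comp]⟩

theorem app_mem_map (φ : Hom P Q) {S : ClosedSub P} {Z : A} {x : P.sec Z}
    (hx : x ∈ S.carrier Z) : φ.app Z x ∈ (map φ S).carrier Z :=
  ⟨Z, 𝟙 Z, inferInstance, x, hx, (Q.res_id _).symm⟩

theorem map_le_iff {φ : Hom P Q} {S : ClosedSub P} {T : ClosedSub Q} :
    map φ S ≤ T ↔ S ≤ comap φ T := by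
  refine ⟨fun h Z x hx => h Z (app_mem_map φ hx), ?_⟩
  rintro h Z y ⟨Z', e, _, x, hxS, hx⟩
  refine T.of_res_mem e ?_
  rw [← hx]
  exact h _ hxS

theorem map_top_eq_top_iff {φ : Hom P Q} : map φ ⊤ = ⊤ ↔ φ.LocallySurjective := by
  constructor
  · intro h Z y
    obtain ⟨Z', e, he, x, -, hx⟩ : y ∈ (map φ ⊤).carrier Z := h ▸ mem_top y
    exact ⟨Z', e, he, x, hx⟩
  · intro h
    refine top_le_iff.1 fun Z y _ => ?_
    obtain ⟨Z', e, he, x, hx⟩ := h Z y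
    exact ⟨Z', e, he, x, trivial, hx⟩

theorem map_mono (φ : Hom P Q) : Monotone (map φ) := by
  rintro S T hST Z y ⟨Z', e, he, x, hxS, hx⟩
  exact ⟨Z', e, he, x, hST _ hxS, hx⟩

theorem comap_mono (φ : Hom P Q) : Monotone (comap φ) := fun _ _ h _ _ hx => h _ hx

theorem comap_strictMono {φ : Hom P Q} (hφ : φ.LocallySurjective) : StrictMono (comap φ) := by
  refine (comap_mono φ).strictMono_of_injective fun S T h => ?_
  have key : ∀ {S T : ClosedSub Q}, comap φ S = comap φ T → S ≤ T := by
    intro S T h Z y hy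
    obtain ⟨Z', e, _, x, hx⟩ := hφ Z y
    refine T.of_res_mem e ?_
    rw [← hx, ← mem_comap, ← h, mem_comap, hx]
    exact S.res_mem e hy
  exact le_antisymm (key h) (key h.symm)

/-- A closed subpresheaf, as a presheaf. -/
def toLinPresheaf (S : ClosedSub P) : LinPresheaf.{v, u, w, u₀, w₁} F k A where
  sec Z := S.carrier Z
  res f := (P.res f).restrict fun _ hx => S.res_mem f hx
  res_id x := Subtype.ext (P.res_id x.1)
  res_comp f g x := Subtype.ext (P.res_comp f g x.1)
  res_add f g x := Subtype.ext (P.res_add f g x.1)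
  res_smul r f x := Subtype.ext (P.res_smul r f x.1)

/-- The inclusion of a closed subpresheaf. -/
def ι (S : ClosedSub P) : Hom S.toLinPresheaf P where
  app Z := (S.carrier Z).subtype
  naturality _ _ := rfl

/-- In an extension, a closed subpresheaf `S` is determined, among those comparable to it, by its
inverse image in the subobject and its closed image in the quotient. -/
theorem eq_of_le_of_comap_eq_of_map_eq {i : Hom P Q} {p : Hom Q R}
    (hip : ∀ Z (y : Q.sec Z), p.app Z y = 0 → ∃ x, i.app Z x = y) {S T : ClosedSub Q}
    (hST : S ≤ T) (hi : comap i S = comap i T) (hp : map p S = map p T) : S = T := by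
  refine le_antisymm hST fun Z y hy => ?_
  obtain ⟨Z', e, _, s, hs, hse⟩ : p.app Z y ∈ (map p S).carrier Z := hp ▸ app_mem_map p hy
  refine S.of_res_mem e ?_
  obtain ⟨x, hx⟩ := hip Z' (Q.res e y - s) (by rw [map_sub, hse, p.naturality, sub_self])
  have hxT : x ∈ (comap i T).carrier Z' := by
    rw [mem_comap, hx]
    exact sub_mem (T.res_mem e hy) (hST _ hs)
  rw [← hi, mem_comap, hx] at hxT
  simpa using add_mem hxT hs

end ClosedSub

/-- The closed subpresheaves of a linear presheaf satisfy both chain conditions. -/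
def HasChainConditions (P : LinPresheaf.{v, u, w, u₀, w₁} F k A) : Prop :=
  WellFoundedGT (ClosedSub P) ∧ WellFoundedLT (ClosedSub P)

theorem HasChainConditions.of_strictMono {α : Type*} [Preorder α] [WellFoundedGT α]
    [WellFoundedLT α] (f : ClosedSub P → α) (hf : StrictMono f) : P.HasChainConditions :=
  ⟨hf.wellFoundedGT, hf.wellFoundedLT⟩

theorem HasChainConditions.of_locallySurjective (hP : P.HasChainConditions) {φ : Hom P Q}
    (hφ : φ.LocallySurjective) : Q.HasChainConditions :=
  have := hP.1
  have := hP.2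
  .of_strictMono _ (ClosedSub.comap_strictMono hφ)

/-- The chain conditions are inherited by extensions. -/
theorem HasChainConditions.of_extension (hP : P.HasChainConditions) (hR : R.HasChainConditions)
    {i : Hom P Q} {p : Hom Q R} (hip : ∀ Z (y : Q.sec Z), p.app Z y = 0 → ∃ x, i.app Z x = y) :
    Q.HasChainConditions := by
  have := hP.1
  have := hP.2
  have := hR.1
  have := hR.2
  refine .of_strictMono (fun S => (ClosedSub.comap i S, ClosedSub.map p S)) fun S T hST => ?_
  refine lt_of_le_of_ne ⟨ClosedSub.comap_mono i hST.le, ClosedSub.map_mono p hST.le⟩ fun h => ?_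
  exact hST.ne (ClosedSub.eq_of_le_of_comap_eq_of_map_eq hip hST.le (Prod.ext_iff.1 h).1
    (Prod.ext_iff.1 h).2)

end LinPresheaf

end LinPresheaf

/-! ### Ind-objects in terms of sections -/

section IndSections

open LinPresheaf

variable {F : Type u₀} [Field F] {k : Type w} [Field k] [Algebra F k]

variable {A : Type u} [Category.{v} A] [Preadditive A] [Linear F A]

namespace LinPresheaf

/-- A presentation of a linear presheaf `P` as the colimit of a small filtered diagram of
representable presheaves, in terms of sections: the universal sections `gen i` are compatible,
every section is a restriction of one of them, and a restriction of `gen i` vanishes only if this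
becomes visible in the diagram. -/
structure Presentation (P : LinPresheaf.{v, u, w, u₀, v} F k A) where
  /-- the index category -/
  I : Type v
  [category : SmallCategory I]
  [isFiltered : IsFiltered I]
  /-- the diagram -/
  D : I ⥤ A
  /-- the universal sections -/
  gen : ∀ i : I, P.sec (D.obj i)
  res_gen : ∀ {i j : I} (h : i ⟶ j), P.res (D.map h) (gen j) = gen i
  exists_res_gen : ∀ {Z : A} (x : P.sec Z), ∃ (i : I) (f : Z ⟶ D.obj i), P.res f (gen i) = x
  exists_comp_eq_zero : ∀ {i : I} {Z : A} (f : Z ⟶ D.obj i), P.res f (gen i) = 0 →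
    ∃ (j : I) (h : i ⟶ j), f ≫ D.map h = 0

attribute [instance] Presentation.category Presentation.isFiltered

/-- The sections of a linear presheaf of `k`-vector spaces, as an `F`-vector space. -/
def RestrictedSec (P : LinPresheaf.{v, u, w, u₀, w₁} F k A) (Z : A) : Type w₁ := P.sec Z

instance (P : LinPresheaf.{v, u, w, u₀, w₁} F k A) (Z : A) : AddCommGroup (P.RestrictedSec Z) :=
  P.addCommGroup Z

instance (P : LinPresheaf.{v, u, w, u₀, w₁} F k A) (Z : A) : Module F (P.RestrictedSec Z) :=
  Module.compHom (P.sec Z) (algebraMap F k)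

/-- The presheaf of `F`-vector spaces underlying a linear presheaf of `k`-vector spaces. -/
def toFunctor (P : LinPresheaf.{v, u, w, u₀, v} F k A) : Aᵒᵖ ⥤ ModuleCat.{v} F where
  obj Z := ModuleCat.of F (P.RestrictedSec Z.unop)
  map f := ModuleCat.ofHom
    { toFun := P.res f.unop
      map_add' := (P.res f.unop).map_add
      map_smul' := fun r x => (P.res f.unop).map_smul (algebraMap F k r) x }
  map_id Z := ModuleCat.hom_ext (LinearMap.ext fun x => P.res_id (Z := Z.unop) x)
  map_comp f g := ModuleCat.hom_ext (LinearMap.ext fun x => P.res_comp g.unop f.unop x)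

/-- The map from a representable presheaf given by a section. -/
def yonedaMap (P : LinPresheaf.{v, u, w, u₀, v} F k A) {X : A} (x : P.sec X) :
    (linearYoneda F A).obj X ⟶ P.toFunctor where
  app Z := ModuleCat.ofHom (Y := P.toFunctor.obj Z)
    { toFun := fun f => (P.res f x : P.sec Z.unop)
      map_add' := fun f g => P.res_add f g x
      map_smul' := fun r f => P.res_smul r f x }
  naturality _ _ f := ModuleCat.hom_ext (LinearMap.ext fun g => P.res_comp f.unop g x)

/-- A presentation by sections yields a colimit cocone. -/
theorem Presentation.isIndObj {P : LinPresheaf.{v, u, w, u₀, v} F k A} (p : P.Presentation) :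
    IsIndObj F A P.toFunctor := by
  refine ⟨p.I, inferInstance, inferInstance, p.D,
    { app := fun i => P.yonedaMap (p.gen i)
      naturality := ?_ }, ⟨evaluationJointlyReflectsColimits _ fun Z => ?_⟩⟩
  · intro i j h
    ext Z f
    change P.res ((show unop Z ⟶ p.D.obj i from f) ≫ p.D.map h) (p.gen j)
      = P.res (show unop Z ⟶ p.D.obj i from f) (p.gen i)
    rw [P.res_comp, p.res_gen]
  have h₁ : ReflectsColimitsOfShape p.I (forget₂ (ModuleCat.{v} F) AddCommGrpCat.{v}) :=
    reflectsColimitsOfShape_of_reflectsIsomorphisms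
  have h₂ : ReflectsColimitsOfShape p.I (forget AddCommGrpCat.{v}) :=
    reflectsColimitsOfShape_of_reflectsIsomorphisms
  refine isColimitOfReflects (forget₂ (ModuleCat.{v} F) AddCommGrpCat.{v}) ?_
  refine isColimitOfReflects (forget AddCommGrpCat.{v}) ?_
  refine Types.FilteredColimit.isColimitOf'.{v, v} _ _ ?_ ?_
  · intro x
    obtain ⟨i, f, hf⟩ := p.exists_res_gen (show P.sec Z.unop from x)
    exact ⟨i, f, hf.symm⟩
  · intro i (f : unop Z ⟶ p.D.obj i) (g : unop Z ⟶ p.D.obj i) (h : P.res f _ = P.res g _)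
    obtain ⟨j, a, ha⟩ := p.exists_comp_eq_zero (f - g) (by
      have := P.res_add (f - g) g (p.gen i)
      rw [sub_add_cancel, h] at this
      simpa using this)
    rw [Preadditive.sub_comp, sub_eq_zero] at ha
    exact ⟨j, a, ha⟩

end LinPresheaf

/-- The universal sections attached to a cocone over a diagram of representable presheaves. -/
def coconeGen {I : Type v} [SmallCategory I] {D : I ⥤ A} {P : Aᵒᵖ ⥤ ModuleCat.{v} F}
    (ι : D ⋙ linearYoneda F A ⟶ (Functor.const I).obj P) (i : I) : P.obj (op (D.obj i)) :=
  ((ι.app i).app (op (D.obj i))).hom (𝟙 (D.obj i))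

/-- The properties of the universal sections attached to a filtered colimit cocone. -/
theorem sections_of_isColimit {I : Type v} [SmallCategory I] [IsFiltered I] {D : I ⥤ A}
    {P : Aᵒᵖ ⥤ ModuleCat.{v} F} (ι : D ⋙ linearYoneda F A ⟶ (Functor.const I).obj P)
    (hc : IsColimit (Cocone.mk P ι)) :
    (∀ {i j : I} (h : i ⟶ j), (P.map (D.map h).op).hom (coconeGen ι j) = coconeGen ι i) ∧
    (∀ {Z : A} (x : P.obj (op Z)), ∃ (i : I) (f : Z ⟶ D.obj i),
        (P.map f.op).hom (coconeGen ι i) = x) ∧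
    (∀ {i : I} {Z : A} (f : Z ⟶ D.obj i), (P.map f.op).hom (coconeGen ι i) = 0 →
        ∃ (j : I) (h : i ⟶ j), f ≫ D.map h = 0) ∧
    (∀ {i : I} {Z : A} (f g : Z ⟶ D.obj i), (P.map (f + g).op).hom (coconeGen ι i) =
        (P.map f.op).hom (coconeGen ι i) + (P.map g.op).hom (coconeGen ι i)) ∧
    (∀ {i : I} {Z : A} (r : F) (f : Z ⟶ D.obj i), (P.map (r • f).op).hom (coconeGen ι i) =
      r • (P.map f.op).hom (coconeGen ι i)) := by
  have key : ∀ (i : I) (Z : A) (f : Z ⟶ D.obj i),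
      (P.map f.op).hom (coconeGen ι i)
        = ((ι.app i).app (op Z)).hom f := by
    intro i Z f
    have h := congrArg (fun φ => φ.hom (𝟙 (D.obj i))) ((ι.app i).naturality f.op)
    refine h.symm.trans (congrArg ((ι.app i).app (op Z)).hom ?_)
    exact Category.comp_id f
  have hZ : ∀ Z : A, IsColimit ((forget AddCommGrpCat.{v}).mapCocone
      ((forget₂ (ModuleCat.{v} F) AddCommGrpCat.{v}).mapCocone
      (((evaluation Aᵒᵖ (ModuleCat.{v} F)).obj (op Z)).mapCocone (Cocone.mk P ι)))) := fun Z =>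
    isColimitOfPreserves _ (isColimitOfPreserves _ (isColimitOfPreserves _ hc))
  refine ⟨?_, ?_, ?_, ?_, ?_⟩
  · intro i j h
    rw [key]
    have h' := congrArg (fun φ => (φ.app (op (D.obj i))).hom (𝟙 (D.obj i))) (ι.naturality h)
    refine Eq.trans (congrArg ((ι.app j).app (op (D.obj i))).hom ?_) h'
    exact (Category.id_comp (D.map h)).symm
  · intro Z x
    obtain ⟨i, f, hf⟩ := Types.jointly_surjective _ (hZ Z) x
    exact ⟨i, f, (key i Z f).trans hf⟩
  · intro i Z f hf
    rw [key] at hf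
    obtain ⟨j, h, hh⟩ := (Types.FilteredColimit.isColimit_eq_iff' (hZ Z)
      (show unop (op Z) ⟶ D.obj i from f) (show unop (op Z) ⟶ D.obj i from 0)).1
        (hf.trans (map_zero ((ι.app i).app (op Z)).hom).symm)
    refine ⟨j, h, ?_⟩
    exact Eq.trans hh zero_comp
  · intro i Z f g
    rw [key, key, key]
    exact map_add _ _ _
  · intro i Z r f
    rw [key, key]
    exact map_smul _ _ _

/-- An ind-object has a presentation by sections. -/
theorem IsIndObj.exists_sections {P : Aᵒᵖ ⥤ ModuleCat.{v} F} (hP : IsIndObj F A P) :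
    ∃ (I : Type v) (_ : SmallCategory I) (_ : IsFiltered I) (D : I ⥤ A)
      (gen : ∀ i, P.obj (op (D.obj i))),
      (∀ {i j : I} (h : i ⟶ j), (P.map (D.map h).op).hom (gen j) = gen i) ∧
      (∀ {Z : A} (x : P.obj (op Z)), ∃ (i : I) (f : Z ⟶ D.obj i),
        (P.map f.op).hom (gen i) = x) ∧
      (∀ {i : I} {Z : A} (f : Z ⟶ D.obj i), (P.map f.op).hom (gen i) = 0 →
        ∃ (j : I) (h : i ⟶ j), f ≫ D.map h = 0) ∧
      (∀ {i : I} {Z : A} (f g : Z ⟶ D.obj i), (P.map (f + g).op).hom (gen i) =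
        (P.map f.op).hom (gen i) + (P.map g.op).hom (gen i)) ∧
      (∀ {i : I} {Z : A} (r : F) (f : Z ⟶ D.obj i), (P.map (r • f).op).hom (gen i) =
        r • (P.map f.op).hom (gen i)) := by
  obtain ⟨I, _, _, D, ι, ⟨hc⟩⟩ := hP
  exact ⟨I, inferInstance, inferInstance, D, coconeGen ι, sections_of_isColimit ι hc⟩

theorem IsIndObj.map_add {P : Aᵒᵖ ⥤ ModuleCat.{v} F} (hP : IsIndObj F A P) {Z' Z : A}
    (f g : Z' ⟶ Z) (x : P.obj (op Z)) :
    (P.map (f + g).op).hom x = (P.map f.op).hom x + (P.map g.op).hom x := by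
  obtain ⟨I, _, _, D, gen, -, h, -, hadd, -⟩ := hP.exists_sections
  obtain ⟨i, a, rfl⟩ := h x
  have key : ∀ f : Z' ⟶ Z, (P.map f.op).hom ((P.map a.op).hom (gen i))
      = (P.map (f ≫ a).op).hom (gen i) := by
    intro f
    rw [op_comp, P.map_comp]
    rfl
  rw [key, key, key, Preadditive.add_comp, hadd]

theorem IsIndObj.map_smul {P : Aᵒᵖ ⥤ ModuleCat.{v} F} (hP : IsIndObj F A P) {Z' Z : A}
    (r : F) (f : Z' ⟶ Z) (x : P.obj (op Z)) :
    (P.map (r • f).op).hom x = r • (P.map f.op).hom x := by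
  obtain ⟨I, _, _, D, gen, -, h, -, -, hsmul⟩ := hP.exists_sections
  obtain ⟨i, a, rfl⟩ := h x
  have key : ∀ f : Z' ⟶ Z, (P.map f.op).hom ((P.map a.op).hom (gen i))
      = (P.map (f ≫ a).op).hom (gen i) := by
    intro f
    rw [op_comp, P.map_comp]
    rfl
  rw [key, key, Linear.smul_comp, hsmul]

namespace FieldModule

/-- The presheaf of `k`-vector spaces underlying a `k`-module in the category of ind-objects. -/
def psh (M : FieldModule F k (LinInd F A)) : LinPresheaf.{v, u, w, u₀, v} F k A where
  sec Z := M.obj.obj.obj (op Z)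
  addCommGroup Z := inferInstance
  module Z :=
    { smul := fun a x => ((M.actHom a).hom.app (op Z)).hom x
      one_smul := fun x => by
        change ((M.actHom 1).hom.app (op Z)).hom x = x
        rw [actHom_one]
        rfl
      mul_smul := fun a b x => by
        change ((M.actHom (a * b)).hom.app (op Z)).hom x = _
        rw [actHom_mul]
        rfl
      smul_zero := fun a => map_zero ((M.actHom a).hom.app (op Z)).hom
      smul_add := fun a => map_add ((M.actHom a).hom.app (op Z)).hom
      add_smul := fun a b x => by
        change ((M.actHom (a + b)).hom.app (op Z)).hom x = _
        rw [actHom_add]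
        rfl
      zero_smul := fun x => by
        change ((M.actHom 0).hom.app (op Z)).hom x = _
        rw [actHom_zero]
        rfl }
  res {Z' Z} f := @LinearMap.mk _ _ _ _ _ _ _ _ _ (_) (_)
    ⟨fun x => (M.obj.obj.map f.op).hom x, fun x y => map_add (M.obj.obj.map f.op).hom x y⟩
    fun a x => congrArg (fun φ => φ.hom x) ((M.actHom a).hom.naturality f.op).symm
  res_id {Z} x := by
    change (M.obj.obj.map (𝟙 (op Z))).hom x = x
    rw [CategoryTheory.Functor.map_id]
    rfl
  res_comp f g x := by
    change (M.obj.obj.map (g.op ≫ f.op)).hom x = _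
    rw [CategoryTheory.Functor.map_comp]
    rfl
  res_add f g x := M.obj.property.map_add f g x
  res_smul r f x := by
    refine (M.obj.property.map_smul r f x).trans ?_
    change _ = ((M.actHom (algebraMap F k r)).hom.app _).hom _
    have : M.actHom (algebraMap F k r) = r • 𝟙 M.obj := M.act.commutes r
    rw [this]
    rfl

theorem psh_smul_def (M : FieldModule F k (LinInd F A)) (a : k) {Z : A} (x : M.psh.sec Z) :
    a • x = ((M.actHom a).hom.app (op Z)).hom x := rfl

variable {M N K : FieldModule F k (LinInd F A)}

/-- The morphism of presheaves underlying a homomorphism of modules. -/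
def pshMap (f : M ⟶ N) : LinPresheaf.Hom M.psh N.psh where
  app Z := @LinearMap.mk _ _ _ _ _ _ _ _ _ (_) (_)
    ⟨fun x => (f.hom.hom.app (op Z)).hom x, fun x y => map_add (f.hom.hom.app (op Z)).hom x y⟩
    fun a x => congrArg (fun φ : M.obj ⟶ N.obj => (φ.hom.app (op Z)).hom x) (actHom_comm f a)
  naturality g x := congrArg (fun φ => φ.hom x) (f.hom.hom.naturality g.op)

@[simp] theorem pshMap_comp_app (f : M ⟶ N) (g : N ⟶ K) {Z : A} (x : M.psh.sec Z) :
    (pshMap (f ≫ g)).app Z x = (pshMap g).app Z ((pshMap f).app Z x) := rfl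

theorem pshMap_injective {f g : M ⟶ N} (h : pshMap f = pshMap g) : f = g := by
  refine FieldModule.hom_ext (ObjectProperty.hom_ext _ (NatTrans.ext (funext fun Z => ?_)))
  refine ModuleCat.hom_ext (LinearMap.ext fun x => ?_)
  exact congrArg (fun φ : LinPresheaf.Hom M.psh N.psh => φ.app Z.unop x) h

theorem algebraMap_smul (r : F) {Z : A} (x : M.psh.sec Z) :
    algebraMap F k r • x = (r • (show M.obj.obj.obj (op Z) from x) : M.obj.obj.obj (op Z)) := by
  rw [psh_smul_def]
  have : M.actHom (algebraMap F k r) = r • 𝟙 M.obj := M.act.commutes r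
  rw [this]
  rfl

/-- The homomorphism of modules given by a morphism of the underlying presheaves. -/
def homMk (φ : LinPresheaf.Hom M.psh N.psh) : M ⟶ N where
  hom := ObjectProperty.homMk
    { app := fun Z => ModuleCat.ofHom
        { toFun := fun x => φ.app Z.unop x
          map_add' := fun x y => map_add (φ.app Z.unop) x y
          map_smul' := fun r x => by
            have h := (φ.app Z.unop).map_smul (algebraMap F k r) x
            exact (congrArg _ (algebraMap_smul r (Z := Z.unop) x).symm).trans
              (h.trans (algebraMap_smul r (φ.app Z.unop x))) }
      naturality := fun Z Z' f => ModuleCat.hom_ext (LinearMap.ext fun x =>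
        φ.naturality f.unop x) }
  comm a := by
    refine ObjectProperty.hom_ext _ (NatTrans.ext (funext fun Z => ?_))
    exact ModuleCat.hom_ext (LinearMap.ext fun x => (φ.app Z.unop).map_smul a x)

/-- The presheaf of a module in the category of ind-objects has a presentation, that of the
underlying ind-object. -/
theorem nonempty_presentation (M : FieldModule F k (LinInd F A)) :
    Nonempty M.psh.Presentation := by
  obtain ⟨I, _, _, D, gen, h₁, h₂, h₃, -, -⟩ := M.obj.property.exists_sections
  exact ⟨{ I := I, D := D, gen := gen, res_gen := h₁, exists_res_gen := h₂,
           exists_comp_eq_zero := h₃ }⟩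

end FieldModule

namespace LinPresheaf.Presentation

/-- The module in the category of ind-objects given by a linear presheaf with a presentation. -/
def toFieldModule {P : LinPresheaf.{v, u, w, u₀, v} F k A} (p : P.Presentation) :
    FieldModule F k (LinInd F A) where
  obj := ⟨P.toFunctor, p.isIndObj⟩
  act := AlgHom.ofLinearMap
    { toFun := fun a => ObjectProperty.homMk
        { app := fun Z => ModuleCat.ofHom (X := P.RestrictedSec Z.unop)
            (Y := P.RestrictedSec Z.unop)
            { toFun := fun x => (a • (show P.sec Z.unop from x) : P.sec Z.unop)
              map_add' := fun x y => smul_add a (show P.sec Z.unop from x) y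
              map_smul' := fun r x => smul_comm a (algebraMap F k r) (show P.sec Z.unop from x) }
          naturality := fun Z Z' f => ModuleCat.hom_ext (LinearMap.ext fun x =>
            ((P.res f.unop).map_smul a (show P.sec Z.unop from x)).symm) }
      map_add' := fun a b => end_ext F fun Z => LinearMap.ext fun x =>
        add_smul a b (show P.sec Z.unop from x)
      map_smul' := fun r a => end_ext F fun Z => LinearMap.ext fun x => by
        change (r • a) • (show P.sec Z.unop from x) = _
        rw [Algebra.smul_def, mul_smul]
        rfl }
    (end_ext F fun Z => LinearMap.ext fun x => one_smul k (show P.sec Z.unop from x))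
    (fun a b => end_ext F fun Z => LinearMap.ext fun x =>
      mul_smul a b (show P.sec Z.unop from x))

/-- The comparison morphism from the presheaf of the associated module. -/
def toHom {P : LinPresheaf.{v, u, w, u₀, v} F k A} (p : P.Presentation) :
    Hom p.toFieldModule.psh P where
  app Z := @LinearMap.mk _ _ _ _ _ _ _ _ _ (_) (_)
    ⟨fun x => (show P.sec Z from x), fun _ _ => rfl⟩ fun _ _ => rfl
  naturality _ _ := rfl

/-- The comparison morphism to the presheaf of the associated module. -/
def invHom {P : LinPresheaf.{v, u, w, u₀, v} F k A} (p : P.Presentation) :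
    Hom P p.toFieldModule.psh where
  app Z := @LinearMap.mk _ _ _ _ _ _ _ _ _ (_) (_)
    ⟨fun x => (show P.sec Z from x), fun _ _ => rfl⟩ fun _ _ => rfl
  naturality _ _ := rfl

end LinPresheaf.Presentation

end IndSections

/-! ### Subobjects and quotients of ind-objects -/

section SubQuotient

open LinPresheaf

variable {F : Type u₀} [Field F] {k : Type w} [Field k] [Algebra F k]
variable {A : Type u} [Category.{v} A] [Abelian A] [Linear F A]

namespace LinPresheaf

section

variable {P : LinPresheaf.{v, u, w, u₀, v} F k A}

/-- Ind-objects are left exact, because filtered colimits of vector spaces are exact. -/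
theorem Presentation.isLeftExact (p : P.Presentation) : P.IsLeftExact where
  separated {Z' Z} e _ x hx := by
    obtain ⟨i, f, rfl⟩ := p.exists_res_gen x
    rw [← P.res_comp] at hx
    obtain ⟨j, h, hh⟩ := p.exists_comp_eq_zero _ hx
    rw [Category.assoc] at hh
    rw [← p.res_gen h, ← P.res_comp, zero_of_epi_comp e hh, P.res_zero]
  exists_res_eq {Z' Z} e _ x hx := by
    obtain ⟨i, f, rfl⟩ := p.exists_res_gen x
    rw [← P.res_comp] at hx
    obtain ⟨j, h, hh⟩ := p.exists_comp_eq_zero _ hx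
    rw [Category.assoc] at hh
    refine ⟨P.res (Abelian.epiDesc e (f ≫ p.D.map h) hh) (p.gen j), ?_⟩
    rw [← P.res_comp, Abelian.comp_epiDesc, P.res_comp, p.res_gen]

end

variable {P : LinPresheaf.{v, u, w, u₀, w₁} F k A} {R : LinPresheaf.{v, u, w, u₀, w₂} F k A}

/-- Among the subobjects of `X` to which the restriction of a section `x` over `X` lies in a closed
subpresheaf, there is a largest one, and the morphisms `f` to `X` for which `P.res f x` lies in
the closed subpresheaf are those that factor through it. -/
theorem ClosedSub.exists_factors_iff (S : ClosedSub P) {X : A} [IsNoetherianObject X]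
    (x : P.sec X) :
    ∃ Y : Subobject X, ∀ {Z : A} (f : Z ⟶ X), P.res f x ∈ S.carrier Z ↔ Y.Factors f := by
  obtain ⟨Y, hY, hmax⟩ := (wellFounded_gt (α := Subobject X)).has_min
    {Y | P.res Y.arrow x ∈ S.carrier _}
    ⟨⊥, by
      rw [Set.mem_ofPred_eq, Subobject.bot_arrow, P.res_zero]
      exact zero_mem _⟩
  refine ⟨Y, fun {Z} f => ⟨fun hf => ?_, fun hf => ?_⟩⟩
  · -- the image of `Y ⊞ Z` in `X` belongs to the set of subobjects, hence is `Y` by maximality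
    let g : (Y : A) ⊞ Z ⟶ X := biprod.desc Y.arrow f
    have hg : P.res g x ∈ S.carrier _ := by
      change P.res (biprod.desc _ _) x ∈ _
      rw [biprod.desc_eq, P.res_add, P.res_comp, P.res_comp]
      exact add_mem (S.res_mem _ hY) (S.res_mem _ hf)
    have hW : P.res (imageSubobject g).arrow x ∈ S.carrier _ := by
      refine S.of_res_mem (factorThruImageSubobject g) ?_
      rwa [← P.res_comp, imageSubobject_arrow_comp]
    have hgW : (imageSubobject g).Factors g := by
      have := Subobject.factors_comp_arrow (factorThruImageSubobject g)
      rwa [imageSubobject_arrow_comp] at this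
    have hle : Y ≤ imageSubobject g := by
      refine Subobject.le_of_factors ?_
      have := Subobject.factors_of_factors_right biprod.inl hgW
      rwa [biprod.inl_desc] at this
    have heq : Y = imageSubobject g := (eq_of_le_of_not_lt hle (hmax _ hW))
    have := Subobject.factors_of_factors_right biprod.inr hgW
    rw [biprod.inr_desc] at this
    exact heq ▸ this
  · rw [← Y.factorThru_arrow f hf, P.res_comp]
    exact S.res_mem _ hY

section Ind

variable {P : LinPresheaf.{v, u, w, u₀, v} F k A}

/-- The subobject of an object of the diagram of a presentation that is cut out by a closed
subpresheaf. -/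
def Presentation.subobj (p : P.Presentation) (S : ClosedSub P)
    (hA : ∀ X : A, IsNoetherianObject X) (i : p.I) : Subobject (p.D.obj i) :=
  have := hA (p.D.obj i)
  (S.exists_factors_iff (p.gen i)).choose

theorem Presentation.subobj_factors_iff (p : P.Presentation) (S : ClosedSub P)
    (hA : ∀ X : A, IsNoetherianObject X) {i : p.I} {Z : A} (f : Z ⟶ p.D.obj i) :
    (p.subobj S hA i).Factors f ↔ P.res f (p.gen i) ∈ S.carrier Z :=
  have := hA (p.D.obj i)
  ((S.exists_factors_iff (p.gen i)).choose_spec f).symm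

theorem Presentation.subobj_factors_map (p : P.Presentation) (S : ClosedSub P)
    (hA : ∀ X : A, IsNoetherianObject X) {i j : p.I} (h : i ⟶ j) :
    (p.subobj S hA j).Factors ((p.subobj S hA i).arrow ≫ p.D.map h) := by
  rw [subobj_factors_iff, P.res_comp, p.res_gen, ← p.subobj_factors_iff S hA]
  exact Subobject.factors_self _

/-- The diagram of the subobjects cut out by a closed subpresheaf. -/
def Presentation.subDiagram (p : P.Presentation) (S : ClosedSub P)
    (hA : ∀ X : A, IsNoetherianObject X) : p.I ⥤ A where
  obj i := (p.subobj S hA i : A)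
  map h := (p.subobj S hA _).factorThru _ (p.subobj_factors_map S hA h)
  map_id i := by
    rw [← cancel_mono (p.subobj S hA i).arrow]
    simp
  map_comp f g := by
    rw [← cancel_mono (p.subobj S hA _).arrow]
    rw [Subobject.factorThru_arrow, Category.assoc, Subobject.factorThru_arrow, ← Category.assoc,
      Subobject.factorThru_arrow, Functor.map_comp, Category.assoc]

/-- The inclusion of the subobjects cut out by a closed subpresheaf. -/
def Presentation.subι (p : P.Presentation) (S : ClosedSub P)
    (hA : ∀ X : A, IsNoetherianObject X) (i : p.I) : (p.subDiagram S hA).obj i ⟶ p.D.obj i :=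
  (p.subobj S hA i).arrow

instance (p : P.Presentation) (S : ClosedSub P)
    (hA : ∀ X : A, IsNoetherianObject X) (i : p.I) : Mono (p.subι S hA i) :=
  inferInstanceAs (Mono (p.subobj S hA i).arrow)

theorem Presentation.subDiagram_map_ι (p : P.Presentation) (S : ClosedSub P)
    (hA : ∀ X : A, IsNoetherianObject X) {i j : p.I} (h : i ⟶ j) :
    (p.subDiagram S hA).map h ≫ p.subι S hA j = p.subι S hA i ≫ p.D.map h :=
  Subobject.factorThru_arrow _ _ (p.subobj_factors_map S hA h)

theorem Presentation.exists_comp_subι_iff (p : P.Presentation) (S : ClosedSub P)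
    (hA : ∀ X : A, IsNoetherianObject X) {i : p.I} {Z : A} (f : Z ⟶ p.D.obj i) :
    (∃ g, g ≫ p.subι S hA i = f) ↔ P.res f (p.gen i) ∈ S.carrier Z := by
  rw [← p.subobj_factors_iff S hA]
  constructor
  · rintro ⟨g, rfl⟩
    exact Subobject.factors_comp_arrow g
  · intro h
    exact ⟨_, Subobject.factorThru_arrow _ f h⟩

/-- A closed subpresheaf of an ind-object is an ind-object. -/
def Presentation.sub (p : P.Presentation) (S : ClosedSub P)
    (hA : ∀ X : A, IsNoetherianObject X) : S.toLinPresheaf.Presentation where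
  I := p.I
  D := p.subDiagram S hA
  gen i := ⟨P.res (p.subι S hA i) (p.gen i),
    (p.exists_comp_subι_iff S hA _).1 ⟨𝟙 _, Category.id_comp _⟩⟩
  res_gen {i j} h := by
    refine Subtype.ext ?_
    change P.res ((p.subDiagram S hA).map h) (P.res (p.subι S hA j) (p.gen j))
      = P.res (p.subι S hA i) (p.gen i)
    rw [← P.res_comp, p.subDiagram_map_ι, P.res_comp, p.res_gen]
  exists_res_gen {Z} x := by
    obtain ⟨i, f, hf⟩ := p.exists_res_gen x.1
    obtain ⟨g, hg⟩ := (p.exists_comp_subι_iff S hA f).2 (hf ▸ x.2)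
    refine ⟨i, g, Subtype.ext ?_⟩
    change P.res g (P.res (p.subι S hA i) (p.gen i)) = _
    rw [← P.res_comp, hg, hf]
  exists_comp_eq_zero {i Z} f hf := by
    have hf' : P.res f (P.res (p.subι S hA i) (p.gen i)) = 0 := congrArg Subtype.val hf
    rw [← P.res_comp] at hf'
    obtain ⟨j, h, hh⟩ := p.exists_comp_eq_zero _ hf'
    refine ⟨j, h, ?_⟩
    rw [← cancel_mono (p.subι S hA j), Category.assoc, p.subDiagram_map_ι, ← Category.assoc, hh,
      zero_comp]

/-- The diagram of the quotients by the subobjects cut out by a closed subpresheaf. -/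
def Presentation.quotDiagram (p : P.Presentation) (S : ClosedSub P)
    (hA : ∀ X : A, IsNoetherianObject X) : p.I ⥤ A where
  obj i := cokernel (p.subobj S hA i).arrow
  map {i j} h := cokernel.desc _ (p.D.map h ≫ cokernel.π (p.subobj S hA j).arrow) (by
    rw [← Category.assoc, ← (p.subobj S hA j).factorThru_arrow _ (p.subobj_factors_map S hA h),
      Category.assoc, cokernel.condition, comp_zero])
  map_id i := by
    rw [← cancel_epi (cokernel.π _)]
    simp
  map_comp f g := by
    rw [← cancel_epi (cokernel.π _)]
    simp

/-- The projections to the quotients by the subobjects cut out by a closed subpresheaf. -/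
def Presentation.quotπ (p : P.Presentation) (S : ClosedSub P)
    (hA : ∀ X : A, IsNoetherianObject X) (i : p.I) : p.D.obj i ⟶ (p.quotDiagram S hA).obj i :=
  cokernel.π (p.subobj S hA i).arrow

instance (p : P.Presentation) (S : ClosedSub P)
    (hA : ∀ X : A, IsNoetherianObject X) (i : p.I) : Epi (p.quotπ S hA i) :=
  inferInstanceAs (Epi (cokernel.π (p.subobj S hA i).arrow))

theorem Presentation.quotπ_map (p : P.Presentation) (S : ClosedSub P)
    (hA : ∀ X : A, IsNoetherianObject X) {i j : p.I} (h : i ⟶ j) :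
    p.quotπ S hA i ≫ (p.quotDiagram S hA).map h = p.D.map h ≫ p.quotπ S hA j :=
  cokernel.π_desc _ _ _

theorem Presentation.comp_quotπ_eq_zero_iff (p : P.Presentation) (S : ClosedSub P)
    (hA : ∀ X : A, IsNoetherianObject X) {i : p.I} {Z : A} (f : Z ⟶ p.D.obj i) :
    f ≫ p.quotπ S hA i = 0 ↔ P.res f (p.gen i) ∈ S.carrier Z := by
  rw [← p.exists_comp_subι_iff S hA]
  constructor
  · intro (h : f ≫ cokernel.π (p.subobj S hA i).arrow = 0)
    have hg := Abelian.monoLift_comp (p.subobj S hA i).arrow f h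
    exact ⟨_, hg⟩
  · rintro ⟨g, rfl⟩
    exact (Category.assoc _ _ _).trans
      ((congrArg (g ≫ ·) (cokernel.condition (p.subobj S hA i).arrow)).trans comp_zero)

end Ind

/-- Over the base field, compatible sections of a presheaf `R` over the objects of a presentation
of `P` define a morphism from `P` to `R`. -/
theorem Presentation.exists_hom {P : LinPresheaf.{v, u, u₀, u₀, v} F F A}
    {R : LinPresheaf.{v, u, u₀, u₀, w₂} F F A} (p : P.Presentation)
    (r : ∀ i : p.I, R.sec (p.D.obj i))
    (hr : ∀ {i j : p.I} (h : i ⟶ j), R.res (p.D.map h) (r j) = r i) :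
    ∃ φ : Hom P R, ∀ i, φ.app _ (p.gen i) = r i := by
  have key : ∀ {Z : A} {i j : p.I} (f : Z ⟶ p.D.obj i) (g : Z ⟶ p.D.obj j),
      P.res f (p.gen i) = P.res g (p.gen j) → R.res f (r i) = R.res g (r j) := by
    intro Z i j f g h
    let a := IsFiltered.leftToMax i j
    let b := IsFiltered.rightToMax i j
    obtain ⟨m, c, hc⟩ := p.exists_comp_eq_zero (f ≫ p.D.map a - g ≫ p.D.map b) (by
      have := P.res_add (f ≫ p.D.map a - g ≫ p.D.map b) (g ≫ p.D.map b) (p.gen _)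
      rw [sub_add_cancel, P.res_comp, P.res_comp, p.res_gen, p.res_gen, h] at this
      simpa using this)
    rw [Preadditive.sub_comp, sub_eq_zero] at hc
    rw [← hr a, ← hr b, ← hr c, ← R.res_comp, ← R.res_comp, ← R.res_comp, ← R.res_comp, hc]
  choose i f hf using fun {Z : A} (x : P.sec Z) => p.exists_res_gen x
  have hφ : ∀ {Z : A} (x : P.sec Z) (j : p.I) (g : Z ⟶ p.D.obj j), P.res g (p.gen j) = x →
      R.res (f x) (r (i x)) = R.res g (r j) := fun x j g h => key _ _ ((hf x).trans h.symm)
  refine ⟨⟨fun Z => ⟨⟨fun x => R.res (f x) (r (i x)), fun x y => ?_⟩, fun a x => ?_⟩,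
    fun {Z' Z} g x => ?_⟩, fun j => ?_⟩
  · let a := IsFiltered.leftToMax (i x) (i y)
    let b := IsFiltered.rightToMax (i x) (i y)
    rw [hφ (x + y) _ (f x ≫ p.D.map a + f y ≫ p.D.map b) (by
      rw [P.res_add, P.res_comp, P.res_comp, p.res_gen, p.res_gen, hf, hf]), R.res_add, R.res_comp,
      R.res_comp, hr, hr]
  · change R.res (f (a • x)) (r (i (a • x))) = a • R.res (f x) (r (i x))
    rw [hφ (a • x) _ (a • f x) (by rw [P.res_smul, hf]; rfl), R.res_smul]
    rfl
  · change R.res (f (P.res g x)) (r (i (P.res g x))) = R.res g (R.res (f x) (r (i x)))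
    rw [hφ (P.res g x) _ (g ≫ f x) (by rw [P.res_comp, hf]), R.res_comp]
  · change R.res (f (p.gen j)) (r (i (p.gen j))) = r j
    rw [hφ (p.gen j) _ (𝟙 _) (P.res_id _), R.res_id]

end LinPresheaf

namespace FieldModule

theorem isLeftExact_psh (M : FieldModule F k (LinInd F A)) : M.psh.IsLeftExact :=
  M.nonempty_presentation.some.isLeftExact

/-- An ind-object, as a module over the base field. -/
def ofInd (N : LinInd F A) : FieldModule F F (LinInd F A) := ⟨N, Algebra.ofId F (End N)⟩

/-- Quotients of ind-objects by closed subpresheaves exist over the base field. -/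
theorem exists_quotient_ofInd (hA : ∀ X : A, IsNoetherianObject X) (N : LinInd F A)
    (S : ClosedSub (ofInd N).psh) :
    ∃ (Q : LinInd F A) (φ : LinPresheaf.Hom (ofInd N).psh (ofInd Q).psh),
      φ.LocallySurjective ∧ ∀ Z x, φ.app Z x = 0 ↔ x ∈ S.carrier Z := by
  obtain ⟨p⟩ := (ofInd N).nonempty_presentation
  let E := p.quotDiagram S hA
  let c := colimit.cocone (E ⋙ linearYoneda F A)
  have hc : IsColimit c := colimit.isColimit _
  let Q : LinInd F A := ⟨c.pt, p.I, inferInstance, inferInstance, E, c.ι, ⟨hc⟩⟩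
  obtain ⟨h₁, h₂, h₃, -, -⟩ := sections_of_isColimit c.ι hc
  let q : (ofInd Q).psh.Presentation :=
    { I := p.I, D := E, gen := coconeGen c.ι, res_gen := h₁, exists_res_gen := h₂,
      exists_comp_eq_zero := h₃ }
  let π : ∀ i : p.I, p.D.obj i ⟶ q.D.obj i := p.quotπ S hA
  have hπe : ∀ i, Epi (π i) := fun i => inferInstanceAs (Epi (p.quotπ S hA i))
  have hπ : ∀ {i j : p.I} (h : i ⟶ j), π i ≫ q.D.map h = p.D.map h ≫ π j := p.quotπ_map S hA
  have hπ₀ : ∀ {i : p.I} {Z : A} (f : Z ⟶ p.D.obj i), f ≫ π i = 0 ↔ _ :=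
    p.comp_quotπ_eq_zero_iff S hA
  obtain ⟨φ, hφ⟩ := p.exists_hom (R := (ofInd Q).psh)
    (fun i => (ofInd Q).psh.res (π i) (q.gen i))
    (fun {i j} h => by
      have := q.res_gen h
      rw [← (ofInd Q).psh.res_comp, ← hπ, (ofInd Q).psh.res_comp]
      exact congrArg _ this)
  refine ⟨Q, φ, fun Z y => ?_, fun Z x => ⟨fun h => ?_, fun h => ?_⟩⟩
  · obtain ⟨i, f, rfl⟩ := q.exists_res_gen y
    obtain ⟨Z', e, g, _, he⟩ := exists_common_refinement f (π i)
    refine ⟨Z', e, inferInstance, (ofInd N).psh.res g (p.gen i), ?_⟩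
    rw [φ.naturality, hφ, ← (ofInd Q).psh.res_comp, ← (ofInd Q).psh.res_comp, he]
  · obtain ⟨i, f, rfl⟩ := p.exists_res_gen x
    rw [φ.naturality, hφ, ← (ofInd Q).psh.res_comp] at h
    obtain ⟨j, a, ha⟩ := q.exists_comp_eq_zero _ h
    rw [Category.assoc, hπ, ← Category.assoc] at ha
    have := (hπ₀ _).1 ha
    rwa [(ofInd N).psh.res_comp, p.res_gen] at this
  · obtain ⟨i, f, rfl⟩ := p.exists_res_gen x
    rw [φ.naturality, hφ, ← (ofInd Q).psh.res_comp, (hπ₀ f).2 h, (ofInd Q).psh.res_zero]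

/-- The quotient of a module in the category of ind-objects by a closed subpresheaf. The action on
the quotient is obtained by descent. -/
theorem exists_quotient (hA : ∀ X : A, IsNoetherianObject X) (M : FieldModule F k (LinInd F A))
    (S : ClosedSub M.psh) :
    ∃ (Q : FieldModule F k (LinInd F A)) (π : M ⟶ Q), (pshMap π).LocallySurjective ∧
      ∀ Z x, (pshMap π).app Z x = 0 ↔ x ∈ S.carrier Z := by
  let M₀ := ofInd M.obj
  let S₀ : ClosedSub M₀.psh :=
    { carrier := fun Z =>
        { carrier := {x | (show M.psh.sec Z from x) ∈ S.carrier Z}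
          add_mem' := fun hx hy => (S.carrier Z).add_mem hx hy
          zero_mem' := (S.carrier Z).zero_mem
          smul_mem' := fun r x hx => by
            have h := (S.carrier Z).smul_mem (algebraMap F k r) hx
            have h' : (show M.psh.sec Z from r • x)
                = algebraMap F k r • (show M.psh.sec Z from x) :=
              (M₀.algebraMap_smul r x).trans (M.algebraMap_smul r x).symm
            rw [← h'] at h
            exact h }
      res_mem := fun f x hx => S.res_mem f hx
      of_res_mem := fun e _ x hx => S.of_res_mem e hx }
  obtain ⟨Q, φ, hφ, hker⟩ := exists_quotient_ofInd hA M.obj S₀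
  let π : M.obj ⟶ Q := (homMk φ : M₀ ⟶ ofInd Q).hom
  have hofInd : ∀ {N N' : LinInd F A} (g : N ⟶ N') (r : F),
      (show N ⟶ N from Algebra.ofId F (End N) r) ≫ g
        = g ≫ (show N' ⟶ N' from Algebra.ofId F (End N') r) := by
    intro N N' g r
    change (r • 𝟙 N) ≫ g = g ≫ (r • 𝟙 N')
    simp
  have hepi : ∀ {g h : Q ⟶ Q}, π ≫ g = π ≫ h → g = h := by
    intro g h hgh
    have := IsSeparated.hom_ext (ofInd Q).isLeftExact_psh.separated hφ
      (g := pshMap (M := ofInd Q) (N := ofInd Q) ⟨g, hofInd g⟩)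
      (h := pshMap (M := ofInd Q) (N := ofInd Q) ⟨h, hofInd h⟩)
      fun Z x => congrArg (fun ψ : M.obj ⟶ Q => (ψ.hom.app (op Z)).hom x) hgh
    exact congrArg FieldModule.Hom.hom (pshMap_injective this)
  have hT : ∀ a : k, ∃ T : Q ⟶ Q, π ≫ T = M.actHom a ≫ π := by
    intro a
    obtain ⟨h, hh⟩ := exists_desc (ofInd Q).isLeftExact_psh φ hφ
      ((pshMap (M := M₀) (N := M₀) ⟨M.actHom a, hofInd _⟩).comp φ) (by
        intro Z x hx
        rw [hker] at hx
        rw [LinPresheaf.Hom.comp_app, hker]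
        exact (S.carrier Z).smul_mem a hx)
    refine ⟨(homMk h : ofInd Q ⟶ ofInd Q).hom, ?_⟩
    have : (homMk φ : M₀ ⟶ ofInd Q) ≫ homMk h
        = (⟨M.actHom a, hofInd _⟩ : M₀ ⟶ M₀) ≫ homMk φ := pshMap_injective hh
    exact congrArg FieldModule.Hom.hom this
  choose T hT using hT
  let Q' : FieldModule F k (LinInd F A) :=
    { obj := Q
      act := AlgHom.ofLinearMap
        { toFun := T
          map_add' := fun a b => hepi (by
            refine (hT _).trans ?_
            rw [actHom_add, Preadditive.add_comp]
            refine (congrArg₂ (· + ·) (hT a) (hT b)).symm.trans ?_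
            exact (Preadditive.comp_add _ _ _ _ _ _).symm)
          map_smul' := fun r a => hepi (by
            refine (hT _).trans ?_
            have h : M.actHom (r • a) = r • M.actHom a := map_smul M.act r a
            rw [h, Linear.smul_comp, ← hT a]
            exact (Linear.comp_smul _ _ _ _ _ _).symm) }
        (hepi (by
          refine (hT _).trans ?_
          rw [actHom_one, Category.id_comp]
          exact (Category.comp_id _).symm))
        (fun a b => hepi (by
          refine (hT _).trans ?_
          change _ = π ≫ (T b ≫ T a)
          rw [actHom_mul, Category.assoc, ← hT a, ← Category.assoc, ← hT b, Category.assoc])) }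
  exact ⟨Q', ⟨π, fun a => (hT a).symm⟩, hφ, hker⟩

end FieldModule

end SubQuotient

/-! ### The presheaves of sections of the modules `F' ⊗ X` -/

section Free

open LinPresheaf FieldModule

variable (F : Type u₀) [Field F] (F' : Type v) [Field F'] [Algebra F F']
variable {A : Type u} [Category.{v} A] [Abelian A] [Linear F A]

/-- The presheaf `Z ↦ F' ⊗ Hom(Z, X)`. -/
abbrev tPsh (X : A) : LinPresheaf.{v, u, v, u₀, v} F F' A := ((tInd F F' A).obj X).psh

/-- The universal section `1 ⊗ 𝟙 X` of `F' ⊗ X`. -/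
def tGen (X : A) : (tPsh F F' X).sec X := ((1 : F') ⊗ₜ[F] 𝟙 X : F' ⊗[F] (X ⟶ X))

variable {F F'}

theorem rTensor_mulLeft_apply (a : F') {M : Type*} [AddCommGroup M] [Module F M]
    (x : F' ⊗[F] M) : (LinearMap.mulLeft F a).rTensor M x = a • x := by
  induction x with
  | zero => simp
  | tmul b m => simp [TensorProduct.smul_tmul']
  | add x y hx hy => rw [map_add, hx, hy, smul_add]

/-- The sections of `F' ⊗ X`, as a tensor product. -/
def tSecEquiv (X Z : A) : (tPsh F F' X).sec Z ≃ₗ[F'] F' ⊗[F] (Z ⟶ X) where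
  toFun x := x
  invFun x := x
  map_add' _ _ := rfl
  map_smul' a x := rTensor_mulLeft_apply a (show F' ⊗[F] (Z ⟶ X) from x)
  left_inv _ := rfl
  right_inv _ := rfl

theorem tSecEquiv_smul_res_tGen {X Z : A} (a : F') (f : Z ⟶ X) :
    tSecEquiv X Z (a • (tPsh F F' X).res f (tGen F F' X)) = a ⊗ₜ[F] f := by
  change (LinearMap.mulLeft F a).rTensor _ ((1 : F') ⊗ₜ[F] (f ≫ 𝟙 X)) = _
  rw [Category.comp_id, LinearMap.rTensor_tmul, LinearMap.mulLeft_apply, mul_one]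

theorem tPsh_induction {X Z : A} {p : (tPsh F F' X).sec Z → Prop} (h0 : p 0)
    (hadd : ∀ x y, p x → p y → p (x + y))
    (hgen : ∀ (a : F') (f : Z ⟶ X), p (a • (tPsh F F' X).res f (tGen F F' X)))
    (x : (tPsh F F' X).sec Z) : p x := by
  refine TensorProduct.induction_on (motive := fun x : F' ⊗[F] (Z ⟶ X) => p x) x h0
    (fun a f => ?_) hadd
  have := hgen a f
  rwa [← (tSecEquiv X Z).symm_apply_apply (a • _), tSecEquiv_smul_res_tGen] at this

/-- Every section of `F' ⊗ X` is a combination of restrictions of the universal section. -/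
theorem tPsh_exists_sum {X Z : A} (x : (tPsh F F' X).sec Z) :
    ∃ (ι : Type) (_ : Fintype ι) (a : ι → F') (f : ι → (Z ⟶ X)),
      x = ∑ i, a i • (tPsh F F' X).res (f i) (tGen F F' X) := by
  refine tPsh_induction (p := fun x => ∃ (ι : Type) (_ : Fintype ι) (a : ι → F') (f : ι → (Z ⟶ X)),
    x = ∑ i, a i • (tPsh F F' X).res (f i) (tGen F F' X))
    ⟨Empty, inferInstance, Empty.elim, fun i => i.elim, by simp⟩ ?_ ?_ x
  · rintro x y ⟨ι, _, a, f, rfl⟩ ⟨κ, _, b, g, rfl⟩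
    exact ⟨ι ⊕ κ, inferInstance, Sum.elim a b, Sum.elim f g, by simp⟩
  · intro a f
    exact ⟨Unit, inferInstance, fun _ => a, fun _ => f, by simp⟩

theorem tHom_ext {R : LinPresheaf.{v, u, v, u₀, w₂} F F' A} {X : A} {φ ψ : Hom (tPsh F F' X) R}
    (h : φ.app X (tGen F F' X) = ψ.app X (tGen F F' X)) : φ = ψ := by
  refine Hom.ext' fun Z x => ?_
  refine tPsh_induction (p := fun x => φ.app Z x = ψ.app Z x) (by simp)
    (fun x y hx hy => by rw [map_add, map_add, hx, hy])
    (fun a f => ?_) x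
  rw [map_smul, map_smul, φ.naturality, ψ.naturality, h]

instance (R : LinPresheaf.{v, u, v, u₀, w₂} F F' A) (Z : A) : Module F' (R.RestrictedSec Z) :=
  R.module Z

instance (R : LinPresheaf.{v, u, v, u₀, w₂} F F' A) (Z : A) :
    IsScalarTower F F' (R.RestrictedSec Z) where
  smul_assoc c a x := by
    rw [Algebra.smul_def, mul_smul]
    rfl

/-- The restrictions of a section `r` over `X`, as a linear function on `Hom(Z, X)`. -/
def resHom {R : LinPresheaf.{v, u, v, u₀, w₂} F F' A} {X : A} (r : R.sec X) (Z : A) :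
    (Z ⟶ X) →ₗ[F] R.RestrictedSec Z where
  toFun f := R.res f r
  map_add' f g := R.res_add f g r
  map_smul' c f := R.res_smul c f r

/-- The linear maps `F' ⊗ Hom(Z, X) → R(Z)`, `a ⊗ f ↦ a • R.res f r`. -/
def tLift {R : LinPresheaf.{v, u, v, u₀, w₂} F F' A} {X : A} (r : R.sec X) (Z : A) :
    (tPsh F F' X).sec Z →ₗ[F'] R.sec Z :=
  (show F' ⊗[F] (Z ⟶ X) →ₗ[F'] R.RestrictedSec Z from
    TensorProduct.AlgebraTensorModule.lift
      (LinearMap.toSpanSingleton F' ((Z ⟶ X) →ₗ[F] R.RestrictedSec Z) (resHom r Z))) ∘ₗ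
    (tSecEquiv X Z).toLinearMap

theorem tLift_smul_res_tGen {R : LinPresheaf.{v, u, v, u₀, w₂} F F' A} {X : A} (r : R.sec X)
    {Z : A} (a : F') (f : Z ⟶ X) :
    tLift r Z (a • (tPsh F F' X).res f (tGen F F' X)) = a • R.res f r := by
  refine (congrArg _ (tSecEquiv_smul_res_tGen a f)).trans ?_
  rfl

/-- The morphism from `F' ⊗ X` that takes the universal section to a given section. -/
def tHom {R : LinPresheaf.{v, u, v, u₀, w₂} F F' A} {X : A} (r : R.sec X) :
    Hom (tPsh F F' X) R where
  app := tLift r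
  naturality {Z' Z} g x := by
    refine tPsh_induction (p := fun x => tLift r Z' ((tPsh F F' X).res g x) =
      R.res g (tLift r Z x)) (by simp) (fun x y hx hy => by simp only [map_add, hx, hy])
      (fun a f => ?_) x
    rw [map_smul, ← LinPresheaf.res_comp, tLift_smul_res_tGen, tLift_smul_res_tGen, map_smul,
      R.res_comp]

@[simp] theorem tHom_tGen {R : LinPresheaf.{v, u, v, u₀, w₂} F F' A} {X : A} (r : R.sec X) :
    (tHom r).app X (tGen F F' X) = r := by
  have := tLift_smul_res_tGen r 1 (𝟙 X)
  rwa [one_smul, LinPresheaf.res_id, one_smul, R.res_id] at this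

theorem tHom_app_tGen {R : LinPresheaf.{v, u, v, u₀, w₂} F F' A} {X : A}
    (φ : Hom (tPsh F F' X) R) : tHom (φ.app X (tGen F F' X)) = φ :=
  tHom_ext (by simp)

theorem pshMap_tInd_map_tGen {X Y : A} (f : X ⟶ Y) :
    (pshMap ((tInd F F' A).map f)).app X (tGen F F' X)
      = (tPsh F F' Y).res f (tGen F F' Y) := by
  change (show (tPsh F F' Y).sec X from (1 : F') ⊗ₜ[F] (𝟙 X ≫ f))
    = (show (tPsh F F' Y).sec X from (1 : F') ⊗ₜ[F] (f ≫ 𝟙 Y))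
  rw [Category.id_comp, Category.comp_id]

/-- `F' ⊗ -` is exact on sections, by flatness of `F'` over `F`. -/
theorem tInd_exact {X' X X'' : A} (i : X' ⟶ X) (p : X ⟶ X'')
    (hip : ∀ {Z : A} (f : Z ⟶ X), f ≫ p = 0 ↔ ∃ g, g ≫ i = f) (Z : A)
    (y : (tPsh F F' X).sec Z) (hy : (pshMap ((tInd F F' A).map p)).app Z y = 0) :
    ∃ x, (pshMap ((tInd F F' A).map i)).app Z x = y := by
  have hex : Function.Exact (Linear.rightComp F Z i) (Linear.rightComp F Z p) := fun f => hip f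
  exact (Module.Flat.lTensor_exact F' hex y).1 hy

theorem finite_tPsh_sec (X Z : A) [Module.Finite F (Z ⟶ X)] :
    Module.Finite F' ((tPsh F F' X).sec Z) :=
  Module.Finite.equiv (tSecEquiv X Z).symm

/-! ### Chain conditions for `F' ⊗ X` -/

/-- If `X` is simple, every finite family of morphisms from `Z` to `X` factors through an
epimorphism from `Z` to a finite direct sum of copies of `X`. -/
theorem exists_epi_factors_of_simple {X : A} [Simple X] {Z : A} {ι : Type} (s : Finset ι)
    (f : ι → (Z ⟶ X)) :
    ∃ (W : A) (e : Z ⟶ W) (_ : Epi e) (n : ℕ) (i : Fin n → (X ⟶ W)) (p : Fin n → (W ⟶ X)),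
      ∑ j, p j ≫ i j = 𝟙 W ∧ ∀ m ∈ s, ∃ g, e ≫ g = f m := by
  classical
  induction s using Finset.induction_on with
  | empty =>
    obtain ⟨O, hO⟩ := HasZeroObject.zero (C := A)
    have : Epi (0 : Z ⟶ O) := ⟨fun _ _ _ => hO.eq_of_src _ _⟩
    refine ⟨O, 0, inferInstance, 0, Fin.elim0, Fin.elim0, ?_, by simp⟩
    exact hO.eq_of_src _ _
  | insert m s hm ih =>
    obtain ⟨W, e, _, n, i, p, hip, hs⟩ := ih
    by_cases h : kernel.ι e ≫ f m = 0
    · refine ⟨W, e, inferInstance, n, i, p, hip, fun m' hm' => ?_⟩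
      rcases Finset.mem_insert.1 hm' with rfl | hm'
      · exact ⟨Abelian.epiDesc e (f m') h, Abelian.comp_epiDesc _ _ _⟩
      · exact hs m' hm'
    · have : Epi (kernel.ι e ≫ f m) := epi_of_nonzero_to_simple h
      have hepi : Epi (biprod.lift e (f m)) := by
        refine Preadditive.epi_of_cancel_zero _ fun {T} g hg => ?_
        rw [biprod.lift_eq, Preadditive.add_comp, Category.assoc, Category.assoc] at hg
        have h₁ : biprod.inr ≫ g = 0 := by
          have := congrArg (kernel.ι e ≫ ·) hg
          simp only [Preadditive.comp_add, ← Category.assoc, kernel.condition, zero_comp,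
            zero_add, comp_zero] at this
          rw [Category.assoc] at this
          exact zero_of_epi_comp _ this
        rw [h₁, comp_zero, add_zero] at hg
        have h₂ := zero_of_epi_comp _ hg
        exact biprod.hom_ext' _ _ (by rw [h₂, comp_zero]) (by rw [h₁, comp_zero])
      refine ⟨W ⊞ X, biprod.lift e (f m), hepi, n + 1,
        Fin.cons biprod.inr fun j => i j ≫ biprod.inl,
        Fin.cons biprod.snd fun j => biprod.fst ≫ p j, ?_, fun m' hm' => ?_⟩
      · rw [Fin.sum_univ_succ]
        simp only [Fin.cons_zero, Fin.cons_succ]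
        have : ∑ j, (biprod.fst ≫ p j) ≫ i j ≫ biprod.inl
            = (biprod.fst : W ⊞ X ⟶ W) ≫ (∑ j, p j ≫ i j) ≫ (biprod.inl : W ⟶ W ⊞ X) := by
          simp [Preadditive.sum_comp, Preadditive.comp_sum]
        rw [this, hip, Category.id_comp, add_comm, biprod.total]
      · rcases Finset.mem_insert.1 hm' with rfl | hm'
        · exact ⟨biprod.snd, biprod.lift_snd _ _⟩
        · obtain ⟨g, hg⟩ := hs m' hm'
          exact ⟨biprod.fst ≫ g, by rw [← Category.assoc, biprod.lift_fst, hg]⟩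

/-- If `X` is simple, a closed subpresheaf of `F' ⊗ X` is determined by its sections over `X`,
which form a subspace of the finite-dimensional space `F' ⊗ End X`. -/
theorem hasChainConditions_tPsh_of_simple (X : A) [Simple X] [Module.Finite F (End X)] :
    (tPsh F F' X).HasChainConditions := by
  have : Module.Finite F (X ⟶ X) := ‹Module.Finite F (End X)›
  have := finite_tPsh_sec (F := F) (F' := F') X X
  refine .of_strictMono (fun S : ClosedSub (tPsh F F' X) => S.carrier X) fun S T hST => ?_
  refine lt_of_le_of_ne (hST.le X) fun h => hST.not_ge fun Z x hx => ?_
  obtain ⟨ι, _, a, f, rfl⟩ := tPsh_exists_sum x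
  obtain ⟨W, e, _, n, i, p, hip, hf⟩ := exists_epi_factors_of_simple Finset.univ f
  choose g hg using fun m => hf m (Finset.mem_univ m)
  -- the section is the restriction along `e` of a section `y` over a power of `X`
  set y : (tPsh F F' X).sec W := ∑ m, a m • (tPsh F F' X).res (g m) (tGen F F' X) with hy
  have hxy : ∑ m, a m • (tPsh F F' X).res (f m) (tGen F F' X) = (tPsh F F' X).res e y := by
    rw [hy, map_sum]
    refine Finset.sum_congr rfl fun m _ => ?_
    rw [map_smul, ← LinPresheaf.res_comp, hg]
  rw [hxy] at hx ⊢
  have hyT : y ∈ T.carrier W := T.of_res_mem e hx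
  refine S.res_mem e ?_
  rw [← (tPsh F F' X).res_id y, ← hip, res_sum]
  refine Submodule.sum_mem _ fun j _ => ?_
  rw [LinPresheaf.res_comp]
  refine S.res_mem _ ?_
  have h' : S.carrier X = T.carrier X := h
  rw [h']
  exact T.res_mem _ hyT

/-- An extension of objects `X'` and `X''` for which `F' ⊗ X'` and `F' ⊗ X''` satisfy the chain
conditions is again such an object. -/
theorem hasChainConditions_tPsh_of_extension {X' X X'' : A} (i : X' ⟶ X) (p : X ⟶ X'')
    (hip : ∀ {Z : A} (f : Z ⟶ X), f ≫ p = 0 ↔ ∃ g, g ≫ i = f)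
    (h' : (tPsh F F' X').HasChainConditions) (h'' : (tPsh F F' X'').HasChainConditions) :
    (tPsh F F' X).HasChainConditions :=
  h'.of_extension h'' (tInd_exact i p hip)

theorem hasChainConditions_tPsh_of_isZero {X : A} (hX : IsZero X) :
    (tPsh F F' X).HasChainConditions := by
  refine .of_strictMono (fun _ : ClosedSub (tPsh F F' X) => ()) fun S T hST => ?_
  refine (hST.not_ge fun Z x _ => ?_).elim
  have : x = 0 := by
    refine tPsh_induction (p := fun x => x = 0) rfl (by rintro x y rfl rfl; simp) (fun a f => ?_) x
    rw [hX.eq_of_tgt f 0, res_zero, smul_zero]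
  rw [this]
  exact zero_mem _

theorem comp_cokernel_π_eq_zero_iff {X' X : A} (i : X' ⟶ X) [Mono i] {Z : A} (f : Z ⟶ X) :
    f ≫ cokernel.π i = 0 ↔ ∃ g, g ≫ i = f := by
  constructor
  · intro h
    exact ⟨Abelian.monoLift i f h, Abelian.monoLift_comp _ _ _⟩
  · rintro ⟨g, rfl⟩
    rw [Category.assoc, cokernel.condition, comp_zero]

/-- The closed subpresheaves of `F' ⊗ X` satisfy both chain conditions, by induction on the
length of `X`. -/
theorem hasChainConditions_tPsh (hA : IsFiniteOver F A) (X : A) :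
    (tPsh F F' X).HasChainConditions := by
  have := (hA.hasFiniteLength X).1
  -- a maximal subobject `Y` of `X` with the property is `X`: otherwise the preimage in `X` of a
  -- simple subobject of `X / Y` is larger and has the property
  obtain ⟨Y, hY, hmax⟩ := (wellFounded_gt (α := Subobject X)).has_min
    {Y | (tPsh F F' (Y : A)).HasChainConditions}
    ⟨⊥, hasChainConditions_tPsh_of_isZero ((isZero_zero A).of_iso Subobject.botCoeIsoZero)⟩
  by_cases hZ : IsZero (cokernel Y.arrow)
  · exact hasChainConditions_tPsh_of_extension Y.arrow (cokernel.π Y.arrow)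
      (comp_cokernel_π_eq_zero_iff _) hY (hasChainConditions_tPsh_of_isZero hZ)
  have := (hA.hasFiniteLength (cokernel Y.arrow)).2
  let S := simpleSubobject hZ
  let s : S ⟶ cokernel Y.arrow := simpleSubobjectArrow hZ
  have := hA.finite_end S
  have hS : (tPsh F F' S).HasChainConditions := hasChainConditions_tPsh_of_simple S
  let Y' : Subobject X := Subobject.mk (pullback.fst (cokernel.π Y.arrow) s)
  have hYY' : Y ≤ Y' := by
    refine Subobject.le_mk_of_comm (pullback.lift Y.arrow 0 ?_) (pullback.lift_fst _ _ _)
    rw [cokernel.condition, zero_comp]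
  let p : (Y' : A) ⟶ S := (Subobject.underlyingIso _).hom ≫ pullback.snd (cokernel.π Y.arrow) s
  have hp : p ≫ s = Y'.arrow ≫ cokernel.π Y.arrow := by
    rw [Category.assoc, ← pullback.condition, ← Category.assoc,
      Subobject.underlyingIso_hom_comp_eq_mk]
  have hY' : (tPsh F F' (Y' : A)).HasChainConditions := by
    refine hasChainConditions_tPsh_of_extension (Subobject.ofLE Y Y' hYY') p (fun {Z} f => ?_)
      hY hS
    rw [← cancel_mono s, zero_comp, Category.assoc, hp, ← Category.assoc,
      comp_cokernel_π_eq_zero_iff]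
    refine exists_congr fun g => ?_
    rw [← cancel_mono Y'.arrow, Category.assoc, Subobject.ofLE_arrow]
  refine (hmax Y' hY' (lt_of_le_of_ne hYY' fun h => ?_)).elim
  -- if `Y' = Y` then the simple object `S` is zero
  have h₁ : Y'.arrow ≫ cokernel.π Y.arrow = 0 := by
    rw [← Subobject.ofLE_arrow h.ge, Category.assoc, cokernel.condition, comp_zero]
  rw [← hp] at h₁
  have h₂ : p ≫ 𝟙 S = 0 := by
    rw [← cancel_mono s, Category.comp_id, h₁, zero_comp]
  exact id_nonzero S (zero_of_epi_comp p h₂)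

end Free

/-! ### Modules of finite length and closed subpresheaves -/

section FiniteLength

open LinPresheaf FieldModule

variable {F : Type u₀} [Field F] {F' : Type v} [Field F'] [Algebra F F']
variable {A : Type u} [Category.{v} A] [Abelian A] [Linear F A]

/-- The homomorphism `F' ⊗ X ⟶ M` given by a section of `M` over `X`. -/
def secHom {M : IndModule F F' A} {X : A} (x : M.psh.sec X) : (tInd F F' A).obj X ⟶ M :=
  homMk (tHom x)

@[simp] theorem pshMap_secHom {M : IndModule F F' A} {X : A} (x : M.psh.sec X) :
    pshMap (secHom x) = tHom x := rfl

/-- A monomorphism is injective on sections over `Z`, by comparing morphisms from `F' ⊗ Z`. -/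
theorem injective_of_mono {M N : IndModule F F' A} (f : M ⟶ N) [Mono f] (Z : A) :
    Function.Injective ((pshMap f).app Z) := by
  intro x y hxy
  have h : secHom x ≫ f = secHom y ≫ f :=
    pshMap_injective (tHom_ext (by simpa using hxy))
  rw [cancel_mono] at h
  simpa using congrArg (fun g => (pshMap g).app Z (tGen F F' Z)) h

theorem mono_of_injective {M N : IndModule F F' A} (f : M ⟶ N)
    (hf : ∀ Z, Function.Injective ((pshMap f).app Z)) : Mono f where
  right_cancellation _ _ hgh := pshMap_injective (Hom.ext' fun Z x => hf Z
    (congrArg (fun g => (pshMap g).app Z x) hgh))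

/-- The image of a monomorphism, which is closed since its source is left exact. -/
def monoRange {M N : IndModule F F' A} (f : M ⟶ N) [Mono f] : ClosedSub N.psh where
  carrier Z := LinearMap.range ((pshMap f).app Z)
  res_mem := by
    rintro Z' Z g _ ⟨x, rfl⟩
    exact ⟨M.psh.res g x, (pshMap f).naturality g x⟩
  of_res_mem := by
    rintro Z' Z e _ y ⟨x, hx⟩
    obtain ⟨x', rfl⟩ := M.isLeftExact_psh.exists_res_eq e x (by
      refine injective_of_mono f _ ?_
      rw [(pshMap f).naturality, hx, ← N.psh.res_comp, kernel.condition, N.psh.res_zero, map_zero])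
    refine ⟨x', sub_eq_zero.1 (N.isLeftExact_psh.separated e _ ?_)⟩
    rw [map_sub, ← (pshMap f).naturality, hx, sub_self]

/-- A subobject is determined by its image, since the inclusion is injective on sections. -/
theorem le_of_monoRange_le {M : IndModule F F' A} {S T : Subobject M}
    (h : monoRange S.arrow ≤ monoRange T.arrow) : S ≤ T := by
  have h' : ∀ (Z : A) (x : (S : IndModule F F' A).psh.sec Z),
      ∃ y, (pshMap T.arrow).app Z y = (pshMap S.arrow).app Z x := fun Z x =>
    ClosedSub.le_def.1 h Z _ ⟨x, rfl⟩
  choose g hg using h'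
  have hinj := injective_of_mono T.arrow
  let φ : LinPresheaf.Hom (S : IndModule F F' A).psh (T : IndModule F F' A).psh :=
    { app := fun Z =>
        { toFun := g Z
          map_add' := fun x y => hinj Z (by rw [map_add, hg, hg, hg, map_add])
          map_smul' := fun a x => hinj Z (by rw [map_smul, hg, hg, map_smul]; rfl) }
      naturality := fun {Z' Z} f x => hinj Z' (by
        rw [(pshMap T.arrow).naturality]
        change (pshMap T.arrow).app Z' (g Z' _) = M.psh.res f ((pshMap T.arrow).app Z (g Z x))
        rw [hg, hg, (pshMap S.arrow).naturality]) }
  exact Subobject.le_of_comm (homMk φ) (pshMap_injective (Hom.ext' fun Z x => hg Z x))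

theorem monoRange_mono {M : IndModule F F' A} {S T : Subobject M} (h : S ≤ T) :
    monoRange S.arrow ≤ monoRange T.arrow := by
  rintro Z _ ⟨x, rfl⟩
  refine ⟨(pshMap (Subobject.ofLE S T h)).app Z x, ?_⟩
  rw [← pshMap_comp_app, Subobject.ofLE_arrow]

/-- Subobjects embed into closed subpresheaves, so the chain conditions for the latter give finite
length. -/
theorem hasFiniteLength_of_hasChainConditions {M : IndModule F F' A}
    (hM : M.psh.HasChainConditions) : HasFiniteLength _ M := by
  have := hM.1
  have := hM.2
  have h : StrictMono fun S : Subobject M => monoRange S.arrow := fun S T hST =>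
    lt_of_le_not_ge (monoRange_mono hST.le) fun h => hST.not_ge (le_of_monoRange_le h)
  exact ⟨⟨h.wellFoundedGT⟩, ⟨h.wellFoundedLT⟩⟩

variable (hA : IsFiniteOver F A)

/-- A closed subpresheaf of a module in the category of ind-objects, as such a module. -/
def subModule (M : IndModule F F' A) (S : ClosedSub M.psh) : IndModule F F' A :=
  (M.nonempty_presentation.some.sub S fun X => (hA.hasFiniteLength X).1).toFieldModule

/-- The inclusion of a closed subpresheaf. -/
def subModuleι (M : IndModule F F' A) (S : ClosedSub M.psh) : subModule hA M S ⟶ M :=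
  homMk ((Presentation.toHom _).comp S.ι)

theorem subModuleι_mem {M : IndModule F F' A} {S : ClosedSub M.psh} {Z : A}
    (x : (subModule hA M S).psh.sec Z) : (pshMap (subModuleι hA M S)).app Z x ∈ S.carrier Z :=
  Subtype.property (p := fun x => x ∈ S.carrier Z) x

theorem exists_subModuleι_eq {M : IndModule F F' A} {S : ClosedSub M.psh} {Z : A}
    {x : M.psh.sec Z} (hx : x ∈ S.carrier Z) :
    ∃ y, (pshMap (subModuleι hA M S)).app Z y = x :=
  ⟨(⟨x, hx⟩ : S.carrier Z), rfl⟩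

instance (M : IndModule F F' A) (S : ClosedSub M.psh) : Mono (subModuleι hA M S) :=
  mono_of_injective _ fun _ _ _ h => Subtype.ext h

/-- Homomorphisms with values in a closed subpresheaf factor through it. -/
def subModuleLift {M N : IndModule F F' A} (S : ClosedSub M.psh) (f : N ⟶ M)
    (hf : ∀ Z x, (pshMap f).app Z x ∈ S.carrier Z) : N ⟶ subModule hA M S :=
  homMk (Hom.comp (Q := S.toLinPresheaf)
    ⟨fun Z => ((pshMap f).app Z).codRestrict _ (hf Z),
      fun g x => Subtype.ext ((pshMap f).naturality g x)⟩ (Presentation.invHom _))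

theorem subModuleLift_ι {M N : IndModule F F' A} (S : ClosedSub M.psh) (f : N ⟶ M)
    (hf : ∀ Z x, (pshMap f).app Z x ∈ S.carrier Z) :
    subModuleLift hA S f hf ≫ subModuleι hA M S = f :=
  pshMap_injective rfl

/-- Closed subpresheaves embed into subobjects, because they are ind-objects themselves. -/
theorem hasChainConditions_of_hasFiniteLength (hA : IsFiniteOver F A)
    {M : IndModule F F' A}
    (hM : HasFiniteLength _ M) : M.psh.HasChainConditions := by
  have := hM.1
  have := hM.2
  refine .of_strictMono (fun S => Subobject.mk (subModuleι hA M S)) fun S T hST => ?_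
  refine lt_of_le_not_ge ?_ fun h => hST.not_ge fun Z x hx => ?_
  · exact Subobject.mk_le_mk_of_comm
      (subModuleLift hA T (subModuleι hA M S) fun Z x => hST.le Z (subModuleι_mem hA x))
      (subModuleLift_ι hA _ _ _)
  · obtain ⟨y, rfl⟩ := exists_subModuleι_eq hA hx
    rw [← Subobject.ofMkLEMk_comp h, pshMap_comp_app]
    exact subModuleι_mem hA _

theorem hasFiniteLength_subModule (hA : IsFiniteOver F A)
    {M : IndModule F F' A} (hM : HasFiniteLength _ M)
    (S : ClosedSub M.psh) : HasFiniteLength _ (subModule hA M S) :=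
  have := hM.1
  have := hM.2
  ⟨isNoetherianObject_of_mono (subModuleι hA M S), isArtinianObject_of_mono (subModuleι hA M S)⟩

/-- The modules `F' ⊗ X` have finite length. -/
theorem hasFiniteLength_tInd (hA : IsFiniteOver F A)
    (X : A) : HasFiniteLength _ ((tInd F F' A).obj X) :=
  hasFiniteLength_of_hasChainConditions (hasChainConditions_tPsh hA X)

/-! ### Generators -/

/-- The closed subpresheaf generated by a section. -/
def LinPresheaf.ClosedSub.span {P : LinPresheaf.{v, u, v, u₀, w₂} F F' A} {X : A}
    (x : P.sec X) : ClosedSub P :=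
  ClosedSub.map (tHom x) ⊤

theorem LinPresheaf.ClosedSub.span_le_iff {P : LinPresheaf.{v, u, v, u₀, w₂} F F' A} {X : A}
    {x : P.sec X} {T : ClosedSub P} : ClosedSub.span x ≤ T ↔ x ∈ T.carrier X := by
  rw [span, map_le_iff]
  constructor
  · intro h
    have := le_def.1 h X (tGen F F' X) trivial
    rwa [mem_comap, tHom_tGen] at this
  · intro h Z y _
    refine tPsh_induction (p := fun y => y ∈ (comap (tHom x) T).carrier Z) (zero_mem _)
      (fun _ _ => add_mem) (fun a f => Submodule.smul_mem _ _ ?_) y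
    rw [mem_comap, (tHom x).naturality, tHom_tGen]
    exact T.res_mem f h

theorem LinPresheaf.ClosedSub.mem_span {P : LinPresheaf.{v, u, v, u₀, w₂} F F' A} {X : A}
    (x : P.sec X) : x ∈ (ClosedSub.span x).carrier X :=
  span_le_iff.1 le_rfl

/-- Under the ascending chain condition every closed subpresheaf is generated by one section,
because finitely many sections can be put together over a direct sum. -/
theorem LinPresheaf.ClosedSub.exists_span_eq {P : LinPresheaf.{v, u, v, u₀, w₂} F F' A}
    (hP : P.HasChainConditions) (S : ClosedSub P) :
    ∃ (X : A) (x : P.sec X), ClosedSub.span x = S := by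
  have := hP.1
  obtain ⟨T, ⟨X, x, hx, rfl⟩, hmax⟩ := (wellFounded_gt (α := ClosedSub P)).has_min
    {T | ∃ (X : A) (x : P.sec X), x ∈ S.carrier X ∧ ClosedSub.span x = T}
    (by
      obtain ⟨O, -⟩ := HasZeroObject.zero (C := A)
      exact ⟨_, O, 0, zero_mem _, rfl⟩)
  refine ⟨X, x, le_antisymm (span_le_iff.2 hx) fun Z y hy => ?_⟩
  let z : P.sec (X ⊞ Z) := P.res biprod.fst x + P.res biprod.snd y
  have hzx : P.res biprod.inl z = x := by
    simp only [z, map_add, ← P.res_comp, biprod.inl_fst, biprod.inl_snd, P.res_id, P.res_zero,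
      add_zero]
  have hzy : P.res biprod.inr z = y := by
    simp only [z, map_add, ← P.res_comp, biprod.inr_fst, biprod.inr_snd, P.res_id, P.res_zero,
      zero_add]
  have hle : ClosedSub.span x ≤ ClosedSub.span z := by
    rw [span_le_iff]
    exact hzx ▸ (ClosedSub.span z).res_mem _ (mem_span z)
  have hzS : z ∈ S.carrier _ := add_mem (S.res_mem _ hx) (S.res_mem _ hy)
  rw [eq_of_le_of_not_lt hle (hmax _ ⟨_, z, hzS, rfl⟩), ← hzy]
  exact (ClosedSub.span z).res_mem _ (mem_span z)

/-- Under the ascending chain condition a presheaf is generated by one section. -/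
theorem exists_locallySurjective_tHom {P : LinPresheaf.{v, u, v, u₀, w₂} F F' A}
    (hP : P.HasChainConditions) :
    ∃ (X : A) (x : P.sec X), (tHom x : Hom (tPsh F F' X) P).LocallySurjective := by
  obtain ⟨X, x, hx⟩ := ClosedSub.exists_span_eq hP ⊤
  exact ⟨X, x, ClosedSub.map_top_eq_top_iff.1 hx⟩

/-! ### Colimits in the scalar extension -/

/-- The presheaf of sections of an object of the scalar extension. -/
abbrev extPsh (M : ScalarExtension F F' A) : LinPresheaf.{v, u, v, u₀, v} F F' A := M.obj.psh

/-- The morphism of presheaves underlying a morphism of the scalar extension. -/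
abbrev extMap {M N : ScalarExtension F F' A} (f : M ⟶ N) : Hom (extPsh M) (extPsh N) :=
  pshMap f.hom

theorem extMap_comp {M N K : ScalarExtension F F' A} (f : M ⟶ N) (g : N ⟶ K) :
    extMap (f ≫ g) = (extMap f).comp (extMap g) := rfl

theorem extMap_injective {M N : ScalarExtension F F' A} {f g : M ⟶ N}
    (h : extMap f = extMap g) : f = g :=
  ObjectProperty.hom_ext _ (pshMap_injective h)

/-- The morphism of the scalar extension given by a morphism of the underlying presheaves. -/
def extHomMk {M N : ScalarExtension F F' A} (φ : Hom (extPsh M) (extPsh N)) : M ⟶ N :=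
  ObjectProperty.homMk (homMk φ)

theorem hasChainConditions_extPsh (hA : IsFiniteOver F A)
    (M : ScalarExtension F F' A) :
    (extPsh M).HasChainConditions :=
  hasChainConditions_of_hasFiniteLength hA M.property

section Colimit

variable {J : Type} [SmallCategory J] {K : J ⥤ ScalarExtension F F' A}
  {c : Cocone K} {R : LinPresheaf.{v, u, v, u₀, w₂} F F' A}

/-- A colimit cocone in the scalar extension is jointly epimorphic even for morphisms to separated
presheaves: the locus where two morphisms agree lies in the scalar extension. -/
theorem colimit_hom_ext (hA : IsFiniteOver F A) (hc : IsColimit c)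
    (hR : R.IsSeparated) {φ ψ : Hom (extPsh c.pt) R}
    (h : ∀ j, (extMap (c.ι.app j)).comp φ = (extMap (c.ι.app j)).comp ψ) : φ = ψ := by
  let E : ClosedSub (extPsh c.pt) := ClosedSub.eqLocus hR φ ψ
  let E' : ScalarExtension F F' A :=
    ⟨subModule hA c.pt.obj E, hasFiniteLength_subModule hA c.pt.property E⟩
  let i : E' ⟶ c.pt := ObjectProperty.homMk (subModuleι hA c.pt.obj E)
  let s : Cocone K :=
    { pt := E'
      ι :=
        { app := fun j => ObjectProperty.homMk (subModuleLift hA E (c.ι.app j).hom fun Z x =>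
            congrArg (fun χ : Hom (extPsh (K.obj j)) R => χ.app Z x) (h j))
          naturality := fun j j' f => extMap_injective (Hom.ext' fun Z x =>
            injective_of_mono (subModuleι hA c.pt.obj E) Z
              (congrArg (fun g => (extMap g).app Z x) (c.w f))) } }
  have hi : hc.desc s ≫ i = 𝟙 c.pt := hc.hom_ext fun j => by
    rw [hc.fac_assoc, Category.comp_id]
    exact ObjectProperty.hom_ext _ (subModuleLift_ι hA _ _ _)
  refine Hom.ext' fun Z x => ?_
  have hx : (extMap i).app Z ((extMap (hc.desc s)).app Z x) = x := by
    rw [← Hom.comp_app, ← extMap_comp, hi]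
    rfl
  have := subModuleι_mem hA ((extMap (hc.desc s)).app Z x)
  rw [← hx]
  exact this

/-- A colimit cocone over a finite diagram in the scalar extension remains universal for morphisms
to left exact presheaves `R`: a compatible family with values in `R` takes its values in an object
of the scalar extension, the image in `R` of some `F' ⊗ X`. -/
theorem exists_colimit_desc [FinCategory J] (hA : IsFiniteOver F A) (hc : IsColimit c)
    (hR : R.IsLeftExact) (φ : ∀ j, Hom (extPsh (K.obj j)) R)
    (hφ : ∀ {j j' : J} (f : j ⟶ j'), (extMap (K.map f)).comp (φ j') = φ j) :
    ∃ χ : Hom (extPsh c.pt) R, ∀ j, (extMap (c.ι.app j)).comp χ = φ j := by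
  classical
  choose X x hx using fun j =>
    exists_locallySurjective_tHom (hasChainConditions_extPsh hA (K.obj j))
  let r : R.sec (⨁ X) := ∑ j, R.res (biproduct.π X j) ((φ j).app _ (x j))
  have hr : ∀ j, R.res (biproduct.ι X j) r = (φ j).app _ (x j) := by
    intro j
    simp only [r, map_sum, ← R.res_comp]
    rw [Finset.sum_eq_single j]
    · rw [biproduct.ι_π_self, R.res_id]
    · intro i _ hij
      rw [biproduct.ι_π_ne _ hij.symm, R.res_zero]
    · intro h
      exact (h (Finset.mem_univ j)).elim
  obtain ⟨Q₀, π, hπ, hker⟩ := exists_quotient (fun X => (hA.hasFiniteLength X).1)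
    ((tInd F F' A).obj (⨁ X)) (ClosedSub.ker hR.separated (tHom r))
  let Q : ScalarExtension F F' A := ⟨Q₀, hasFiniteLength_of_hasChainConditions
    ((hasChainConditions_tPsh hA (⨁ X)).of_locallySurjective hπ)⟩
  obtain ⟨ρ, hρ⟩ := exists_desc hR (pshMap π) hπ (tHom r) fun Z y hy => (hker Z y).1 hy
  have hρ_inj : ∀ Z (q : (extPsh Q).sec Z), ρ.app Z q = 0 → q = 0 := by
    intro Z q hq
    obtain ⟨Z', e, _, y, hy⟩ := hπ Z q
    refine Q.obj.isLeftExact_psh.separated e q ?_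
    rw [← hy, hker, ClosedSub.mem_ker, ← hρ, Hom.comp_app, hy, ρ.naturality, hq, map_zero]
  have hρ_mono : ∀ {P : LinPresheaf.{v, u, v, u₀, v} F F' A} {f g : Hom P (extPsh Q)},
      f.comp ρ = g.comp ρ → f = g := by
    intro P f g hfg
    refine Hom.ext' fun Z y => sub_eq_zero.1 (hρ_inj Z _ ?_)
    rw [map_sub, sub_eq_zero]
    exact congrArg (fun χ : Hom P R => χ.app Z y) hfg
  -- the family factors through the image `Q` of `F' ⊗ ⨁ X` in `R`
  have hχ : ∀ j, ∃ χ : Hom (extPsh (K.obj j)) (extPsh Q), χ.comp ρ = φ j := by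
    intro j
    let q : (extPsh Q).sec (X j) :=
      (pshMap π).app _ ((tPsh F F' (⨁ X)).res (biproduct.ι X j) (tGen F F' _))
    have hq : (tHom q).comp ρ = (tHom (x j)).comp (φ j) := by
      refine tHom_ext ?_
      rw [Hom.comp_app, Hom.comp_app, tHom_tGen, tHom_tGen, ← Hom.comp_app, hρ,
        (tHom r).naturality, tHom_tGen, hr]
    obtain ⟨χ, hχ⟩ := exists_desc Q.obj.isLeftExact_psh (tHom (x j)) (hx j) (tHom q)
      (fun Z y hy => hρ_inj Z _ (by rw [← Hom.comp_app, hq, Hom.comp_app, hy, map_zero]))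
    refine ⟨χ, IsSeparated.hom_ext hR.separated (hx j) fun Z y => ?_⟩
    rw [Hom.comp_app, ← Hom.comp_app (tHom (x j)) χ, hχ, ← Hom.comp_app, hq, Hom.comp_app]
  choose χ hχ using hχ
  let s : Cocone K :=
    { pt := Q
      ι :=
        { app := fun j => extHomMk (χ j)
          naturality := fun j j' f => extMap_injective (hρ_mono (by
            change (extMap (K.map f)).comp ((χ j').comp ρ) = (χ j).comp ρ
            rw [hχ, hχ, hφ])) } }
  refine ⟨(extMap (hc.desc s)).comp ρ, fun j => ?_⟩
  have : extMap (c.ι.app j ≫ hc.desc s) = χ j := by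
    rw [hc.fac]
    rfl
  rw [← hχ j, ← this]
  rfl

end Colimit

end FiniteLength

/-! ### The presheaves `Z ↦ Hom(V Z, b)` and universal morphisms to them -/

section Universal

open LinPresheaf FieldModule

variable {F : Type u₀} [Field F] {F' : Type v} [Field F'] [Algebra F F']
variable {A : Type u} [Category.{v} A] [Abelian A] [Linear F A]
variable {B : Type u₁} [Category.{v₁} B] [Abelian B] [Linear F' B]

theorem IsLinearFunctor.additive {C : Type u} [Category.{v} C] [Preadditive C] [Linear F C]
    {k : Type w} [Field k] [Algebra F k] {D : Type u₁} [Category.{v₁} D] [Preadditive D]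
    [Linear k D] {V : C ⥤ D} (hV : IsLinearFunctor F k V) : V.Additive :=
  ⟨hV.map_add _ _⟩

variable {V : A ⥤ B} (hV : IsLinearFunctor F F' V)

/-- The presheaf `Z ↦ Hom(V Z, b)` of `F'`-vector spaces. -/
def homPsh (b : B) : LinPresheaf.{v, u, v, u₀, v₁} F F' A where
  sec Z := V.obj Z ⟶ b
  res f := Linear.leftComp F' b (V.map f)
  res_id x := by simp
  res_comp f g x := by simp
  res_add f g x := by simp [hV.map_add]
  res_smul r f x := by simp [hV.map_smul]

/-- A section of `Z ↦ Hom(V Z, b)`. -/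
def homSec {b : B} {Z : A} (g : V.obj Z ⟶ b) : (homPsh hV b).sec Z := g

/-- A section of `Z ↦ Hom(V Z, b)`, as a morphism. -/
def secToHom {b : B} {Z : A} (g : (homPsh hV b).sec Z) : V.obj Z ⟶ b := g

@[simp] theorem secToHom_homSec {b : B} {Z : A} (g : V.obj Z ⟶ b) :
    secToHom hV (homSec hV g) = g := rfl

/-- Right exactness of `V` makes `Z ↦ Hom(V Z, b)` left exact. -/
theorem isLeftExact_homPsh [PreservesFiniteColimits V] (b : B) : (homPsh hV b).IsLeftExact where
  separated e _ x hx := zero_of_epi_comp (V.map e) hx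
  exists_res_eq {Z' Z} e _ x hx := by
    have := hV.additive
    have hc := CokernelCofork.mapIsColimit _
      (Abelian.epiIsCokernelOfKernel _ (kernelIsKernel e)) V
    exact ⟨hc.desc (CokernelCofork.ofπ (secToHom hV x) hx), hc.fac _ WalkingParallelPair.one⟩

/-- Composition with a morphism `b ⟶ b'`. -/
def homPshMap {b b' : B} (h : b ⟶ b') : Hom (homPsh hV b) (homPsh hV b') where
  app Z := Linear.rightComp F' (V.obj Z) h
  naturality f x := Category.assoc (V.map f) (secToHom hV x) h

variable {P : LinPresheaf.{v, u, v, u₀, w₂} F F' A}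

theorem comp_homPshMap_comp {b b' b'' : B} (u : Hom P (homPsh hV b)) (h : b ⟶ b') (h' : b' ⟶ b'') :
    u.comp (homPshMap hV (h ≫ h')) = (u.comp (homPshMap hV h)).comp (homPshMap hV h') :=
  Hom.ext' fun Z x => (Category.assoc (secToHom hV (u.app Z x)) h h').symm

theorem comp_homPshMap_id {b : B} (u : Hom P (homPsh hV b)) : u.comp (homPshMap hV (𝟙 b)) = u :=
  Hom.ext' fun Z x => Category.comp_id (secToHom hV (u.app Z x))

/-- A morphism `u` from `P` to the presheaf `Z ↦ Hom(V Z, b₀)` is universal if it makes `b₀`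
represent the functor of morphisms from `P` to presheaves of this form; in other words, if `b₀` is
the value at `P` of the extension of `V`. -/
def IsUniversal {b₀ : B} (u : Hom P (homPsh hV b₀)) : Prop :=
  ∀ (b : B) (c : Hom P (homPsh hV b)), ∃! h : b₀ ⟶ b, u.comp (homPshMap hV h) = c

variable {hV}

/-- The morphism between representing objects induced by a universal morphism. -/
def IsUniversal.desc {b₀ : B} {u : Hom P (homPsh hV b₀)} (hu : IsUniversal hV u) {b : B}
    (c : Hom P (homPsh hV b)) : b₀ ⟶ b := (hu b c).choose

@[simp] theorem IsUniversal.fac {b₀ : B} {u : Hom P (homPsh hV b₀)} (hu : IsUniversal hV u) {b : B}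
    (c : Hom P (homPsh hV b)) : u.comp (homPshMap hV (hu.desc c)) = c := (hu b c).choose_spec.1

theorem IsUniversal.hom_ext {b₀ : B} {u : Hom P (homPsh hV b₀)} (hu : IsUniversal hV u) {b : B}
    {h h' : b₀ ⟶ b} (e : u.comp (homPshMap hV h) = u.comp (homPshMap hV h')) : h = h' :=
  (hu b _).unique e rfl

/-- A criterion for universality in terms of a presentation of `P`: a generating section `x` and a
generator `y` of the kernel of `tHom x`. -/
theorem isUniversal_of_presentation [PreservesFiniteColimits V] {X₀ X₁ : A} {x : P.sec X₀}
    (hx : (tHom x : Hom (tPsh F F' X₀) P).LocallySurjective) {y : (tPsh F F' X₀).sec X₁}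
    (hy : (tHom x : Hom (tPsh F F' X₀) P).app X₁ y = 0) {b₀ : B} (u : Hom P (homPsh hV b₀))
    (hepi : Epi (secToHom hV (u.app X₀ x)))
    (hdesc : ∀ (b : B) (g : V.obj X₀ ⟶ b), (tHom (homSec hV g)).app X₁ y = 0 →
      ∃ h : b₀ ⟶ b, secToHom hV (u.app X₀ x) ≫ h = g) : IsUniversal hV u := by
  intro b c
  have hc : tHom (c.app X₀ x) = (tHom x : Hom (tPsh F F' X₀) P).comp c :=
    tHom_ext (by simp)
  obtain ⟨h, hh⟩ := hdesc b (secToHom hV (c.app X₀ x)) (by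
    refine (congrArg (fun φ : Hom (tPsh F F' X₀) (homPsh hV b) => φ.app X₁ y) hc).trans ?_
    rw [Hom.comp_app, hy, map_zero])
  refine ⟨h, ?_, fun h' hh' => ?_⟩
  · refine IsSeparated.hom_ext (isLeftExact_homPsh hV b).separated hx fun Z z => ?_
    refine congrArg (fun φ : Hom (tPsh F F' X₀) (homPsh hV b) => φ.app Z z)
      (tHom_ext (φ := (tHom x).comp (u.comp (homPshMap hV h))) (ψ := (tHom x).comp c) ?_)
    simp only [Hom.comp_app, tHom_tGen]
    exact hh
  · rw [← cancel_epi (secToHom hV (u.app X₀ x)), hh, ← hh']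
    rfl

/-- A separated presheaf with chain conditions has a presentation `F' ⊗ X₁ ⟶ F' ⊗ X₀ ⟶ P ⟶ 0`,
given by a generating section `x` and a generator `y` of the kernel of `tHom x`. -/
theorem exists_tPsh_presentation (hA : IsFiniteOver F A) (hP : P.HasChainConditions)
    (hsep : P.IsSeparated) :
    ∃ (X₀ X₁ : A) (x : P.sec X₀) (y : (tPsh F F' X₀).sec X₁),
      (tHom x : Hom (tPsh F F' X₀) P).LocallySurjective ∧
        ClosedSub.span y = ClosedSub.ker hsep (tHom x) := by
  obtain ⟨X₀, x, hx⟩ := exists_locallySurjective_tHom hP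
  obtain ⟨X₁, y, hy⟩ := ClosedSub.exists_span_eq (hasChainConditions_tPsh hA X₀)
    (ClosedSub.ker hsep (tHom x))
  exact ⟨X₀, X₁, x, y, hx, hy⟩

/-- A morphism from `F' ⊗ X₀` that kills a generator of the kernel of `tHom x` kills the whole
kernel. -/
theorem app_eq_zero_of_span_eq_ker {R : LinPresheaf.{v, u, v, u₀, w₃} F F' A}
    (hR : R.IsSeparated) {hsep : P.IsSeparated} {X₀ X₁ : A} {x : P.sec X₀}
    {y : (tPsh F F' X₀).sec X₁} (hy : ClosedSub.span y = ClosedSub.ker hsep (tHom x))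
    {φ : Hom (tPsh F F' X₀) R} (hφ : φ.app X₁ y = 0) (Z : A) (z : (tPsh F F' X₀).sec Z)
    (hz : (tHom x : Hom (tPsh F F' X₀) P).app Z z = 0) : φ.app Z z = 0 := by
  have h : ClosedSub.span y ≤ ClosedSub.ker hR φ := ClosedSub.span_le_iff.2 hφ
  rw [hy] at h
  exact ClosedSub.le_def.1 h Z z hz

variable (hV) in
/-- Universal morphisms exist: the representing object is the cokernel of the morphism
`V X₁ ⟶ V X₀` that corresponds to a presentation `F' ⊗ X₁ ⟶ F' ⊗ X₀ ⟶ P ⟶ 0`. -/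
theorem exists_isUniversal (hA : IsFiniteOver F A) [PreservesFiniteColimits V]
    (hP : P.HasChainConditions) (hsep : P.IsSeparated) :
    ∃ (b₀ : B) (u : Hom P (homPsh hV b₀)), IsUniversal hV u := by
  obtain ⟨X₀, X₁, x, y, hx, hy⟩ := exists_tPsh_presentation hA hP hsep
  let f : V.obj X₁ ⟶ V.obj X₀ := secToHom hV ((tHom (homSec hV (𝟙 (V.obj X₀)))).app X₁ y)
  -- the section of `Z ↦ Hom(V Z, b)` corresponding to `y` and `g : V X₀ ⟶ b` is `f ≫ g`
  have hf : ∀ {b : B} (g : V.obj X₀ ⟶ b),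
      secToHom hV ((tHom (homSec hV g)).app X₁ y) = f ≫ g := by
    intro b g
    have : (tHom (homSec hV g) : Hom (tPsh F F' X₀) _)
        = (tHom (homSec hV (𝟙 (V.obj X₀)))).comp (homPshMap hV g) := by
      refine tHom_ext ?_
      rw [Hom.comp_app, tHom_tGen, tHom_tGen]
      exact (Category.id_comp g).symm
    rw [this]
    rfl
  have hu := exists_desc (isLeftExact_homPsh hV (cokernel f)) (tHom x) hx
    (tHom (homSec hV (cokernel.π f)))
    (app_eq_zero_of_span_eq_ker (isLeftExact_homPsh hV (cokernel f)).separated hy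
      ((hf _).trans (cokernel.condition f)))
  obtain ⟨u, hu⟩ := hu
  have hux : secToHom hV (u.app X₀ x) = cokernel.π f := by
    have := congrArg (fun φ : Hom (tPsh F F' X₀) _ => φ.app X₀ (tGen F F' X₀)) hu
    simp only [Hom.comp_app, tHom_tGen] at this
    rw [this]
    rfl
  have hy₀ : (tHom x).app X₁ y = 0 := by
    rw [← ClosedSub.mem_ker hsep, ← hy]
    exact ClosedSub.mem_span y
  refine ⟨cokernel f, u, isUniversal_of_presentation hx hy₀ u ?_ fun b g hg => ?_⟩
  · rw [hux]
    infer_instance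
  · rw [hux]
    exact ⟨cokernel.desc f g ((hf g).symm.trans hg), cokernel.π_desc _ _ _⟩

end Universal

/-! ### Existence of the extension -/

section Existence

open LinPresheaf FieldModule

variable {F : Type u₀} [Field F] {F' : Type v} [Field F'] [Algebra F F']
variable {A : Type u} [Category.{v} A] [Abelian A] [Linear F A]
variable {B : Type u₁} [Category.{v₁} B] [Abelian B] [Linear F' B]
variable {V : A ⥤ B} {hV : IsLinearFunctor F F' V}

/-- A natural family of universal morphisms, which exhibits `V'` as the extension of `V`. -/
structure UniversalFamily (hV : IsLinearFunctor F F' V) (V' : ScalarExtension F F' A ⥤ B) where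
  /-- the universal morphisms -/
  app : ∀ M : ScalarExtension F F' A, Hom (extPsh M) (homPsh hV (V'.obj M))
  naturality : ∀ {M N : ScalarExtension F F' A} (f : M ⟶ N),
    (app M).comp (homPshMap hV (V'.map f)) = (extMap f).comp (app N)
  isUniversal : ∀ M, IsUniversal hV (app M)

variable (hV) in
/-- Choices of universal morphisms define a functor with a universal family. -/
theorem exists_universalFamily (hA : IsFiniteOver F A) [PreservesFiniteColimits V] :
    ∃ V' : ScalarExtension F F' A ⥤ B, Nonempty (UniversalFamily hV V') := by
  choose obj u hu using fun M : ScalarExtension F F' A =>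
    exists_isUniversal hV hA (hasChainConditions_extPsh hA M) M.obj.isLeftExact_psh.separated
  let V' : ScalarExtension F F' A ⥤ B :=
    { obj := obj
      map := fun {_ N} f => (hu _).desc ((extMap f).comp (u N))
      map_id := fun M => (hu M).hom_ext (by
        rw [IsUniversal.fac, comp_homPshMap_id]
        rfl)
      map_comp := fun {M N K} f g => (hu M).hom_ext (by
        rw [IsUniversal.fac, comp_homPshMap_comp, IsUniversal.fac]
        change (extMap f).comp ((extMap g).comp (u K))
          = (extMap f).comp ((u N).comp (homPshMap hV _))
        rw [IsUniversal.fac]) }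
  exact ⟨V', ⟨⟨u, fun f => (hu _).fac _, hu⟩⟩⟩

namespace UniversalFamily

variable {V' : ScalarExtension F F' A ⥤ B} (u : UniversalFamily hV V')

theorem app_extMap {M N : ScalarExtension F F' A} (f : M ⟶ N) {Z : A} (x : (extPsh M).sec Z) :
    secToHom hV ((u.app N).app Z ((extMap f).app Z x))
      = secToHom hV ((u.app M).app Z x) ≫ V'.map f :=
  congrArg (fun φ : Hom (extPsh M) _ => φ.app Z x) (u.naturality f).symm

theorem isLinearFunctor (u : UniversalFamily hV V') : IsLinearFunctor F' F' V' where
  map_add {M N} f g := (u.isUniversal M).hom_ext (by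
    rw [u.naturality]
    refine Hom.ext' fun Z x => ?_
    refine (map_add ((u.app N).app Z) ((extMap f).app Z x) ((extMap g).app Z x)).trans ?_
    refine (congrArg₂ (fun s t : V.obj Z ⟶ V'.obj N => s + t) (u.app_extMap f x)
      (u.app_extMap g x)).trans ?_
    exact (Preadditive.comp_add _ _ _ (secToHom hV ((u.app M).app Z x)) _ _).symm)
  map_smul {M N} a f := (u.isUniversal M).hom_ext (by
    rw [u.naturality]
    refine Hom.ext' fun Z x => ?_
    refine (map_smul ((u.app N).app Z) a ((extMap f).app Z x)).trans ?_
    refine (congrArg (fun s : V.obj Z ⟶ V'.obj N => a • s) (u.app_extMap f x)).trans ?_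
    exact (Linear.comp_smul _ _ _ (secToHom hV ((u.app M).app Z x)) a _).symm)

/-- A functor with a universal family is right exact, since colimit cocones of the scalar extension
are universal for morphisms to the left exact presheaves `Z ↦ Hom(V Z, b)`. -/
theorem preservesFiniteColimits (u : UniversalFamily hV V') (hA : IsFiniteOver F A)
    [PreservesFiniteColimits V] : PreservesFiniteColimits V' := by
  refine ⟨fun J _ _ => ⟨fun {K} => ⟨fun {c} hc => ⟨?_⟩⟩⟩⟩
  have hex : ∀ s : Cocone (K ⋙ V'),
      ∃ χ : Hom (extPsh c.pt) (homPsh hV s.pt), ∀ j, (extMap (c.ι.app j)).comp χ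
        = (u.app (K.obj j)).comp (homPshMap hV (s.ι.app j)) := by
    intro s
    refine exists_colimit_desc hA hc (isLeftExact_homPsh hV s.pt) _ fun {j j'} f => ?_
    rw [← s.w f]
    refine Eq.trans ?_ (comp_homPshMap_comp hV _ (V'.map (K.map f)) (s.ι.app j')).symm
    rw [u.naturality]
    rfl
  choose χ hχ using hex
  exact
    { desc := fun s => (u.isUniversal c.pt).desc (χ s)
      fac := fun s j => (u.isUniversal (K.obj j)).hom_ext (by
        refine (comp_homPshMap_comp hV _ (V'.map (c.ι.app j)) _).trans ?_
        rw [u.naturality, ← hχ s j]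
        exact congrArg (Hom.comp (extMap (c.ι.app j))) ((u.isUniversal c.pt).fac (χ s)))
      uniq := fun s m hm => (u.isUniversal c.pt).hom_ext (by
        rw [IsUniversal.fac]
        refine colimit_hom_ext hA hc (isLeftExact_homPsh hV s.pt).separated fun j => ?_
        rw [hχ s j, ← hm j]
        refine Eq.trans ?_ (comp_homPshMap_comp hV _ (V'.map (c.ι.app j)) m).symm
        rw [u.naturality]
        rfl) }

/-- A functor with a universal family extends `V`. -/
def iso (ht : ∀ X : A, HasFiniteLength _ ((tInd F F' A).obj X)) :
    V ≅ scalarExtensionFunctor ht ⋙ V' :=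
  NatIso.ofComponents
    (fun X =>
      { hom := secToHom hV ((u.app ((scalarExtensionFunctor ht).obj X)).app X (tGen F F' X))
        inv := (u.isUniversal ((scalarExtensionFunctor ht).obj X)).desc
          (tHom (homSec hV (𝟙 (V.obj X))) : Hom (tPsh F F' X) _)
        hom_inv_id := by
          have := (u.isUniversal ((scalarExtensionFunctor ht).obj X)).fac
            (tHom (homSec hV (𝟙 (V.obj X))) : Hom (tPsh F F' X) _)
          have := congrArg (fun φ : Hom (tPsh F F' X) _ => φ.app X (tGen F F' X)) this
          exact this.trans (tHom_tGen _)
        inv_hom_id := by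
          refine (u.isUniversal ((scalarExtensionFunctor ht).obj X)).hom_ext ?_
          refine (comp_homPshMap_comp hV _ _ _).trans ?_
          refine Eq.trans ?_ (comp_homPshMap_id hV _).symm
          refine (congrArg (fun φ => Hom.comp φ (homPshMap hV _)) (IsUniversal.fac _ _)).trans ?_
          refine tHom_ext ?_
          exact (congrArg ((homPshMap hV _).app X) (tHom_tGen _)).trans (Category.id_comp _) })
    (fun {X Y} f => by
      refine Eq.trans ?_ (u.app_extMap ((scalarExtensionFunctor ht).map f) (tGen F F' X))
      refine Eq.trans ?_ (congrArg ((u.app ((scalarExtensionFunctor ht).obj Y)).app X)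
        (pshMap_tInd_map_tGen f).symm)
      exact ((u.app ((scalarExtensionFunctor ht).obj Y)).naturality f (tGen F F' Y)).symm)

end UniversalFamily

end Existence

/-! ### Uniqueness of the extension -/

section Uniqueness

open LinPresheaf FieldModule

variable {F : Type u₀} [Field F] {F' : Type v} [Field F'] [Algebra F F']
variable {A : Type u} [Category.{v} A] [Abelian A] [Linear F A]
variable {B : Type u₁} [Category.{v₁} B] [Abelian B] [Linear F' B]
variable {V : A ⥤ B} (hV : IsLinearFunctor F F' V)
variable {ht : ∀ X : A, HasFiniteLength _ ((tInd F F' A).obj X)}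
variable {V' : ScalarExtension F F' A ⥤ B} (hV' : IsLinearFunctor F' F' V')
variable (α : V ≅ scalarExtensionFunctor ht ⋙ V')

/-- The morphism of the scalar extension given by a section. -/
def extSecHom (ht : ∀ X : A, HasFiniteLength _ ((tInd F F' A).obj X))
    {M : ScalarExtension F F' A} {X : A} (x : (extPsh M).sec X) :
    (scalarExtensionFunctor ht).obj X ⟶ M :=
  ObjectProperty.homMk (secHom x)

theorem extSecHom_res {M : ScalarExtension F F' A} {Z' Z : A} (f : Z' ⟶ Z)
    (x : (extPsh M).sec Z) : extSecHom ht ((extPsh M).res f x)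
      = (scalarExtensionFunctor ht).map f ≫ extSecHom ht x := by
  refine extMap_injective (tHom_ext ?_)
  refine (tHom_tGen _).trans ?_
  refine Eq.trans ?_ (congrArg ((tHom x).app Z') (pshMap_tInd_map_tGen f).symm)
  rw [(tHom x).naturality, tHom_tGen]

theorem extSecHom_extMap {M N : ScalarExtension F F' A} (f : M ⟶ N) {Z : A}
    (x : (extPsh M).sec Z) :
    extSecHom ht ((extMap f).app Z x) = extSecHom ht x ≫ f := by
  refine extMap_injective (tHom_ext ?_)
  refine (tHom_tGen _).trans ?_
  exact congrArg ((extMap f).app Z) (tHom_tGen x).symm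

theorem extSecHom_tGen (X : A) :
    extSecHom ht (M := (scalarExtensionFunctor ht).obj X) (tGen F F' X) = 𝟙 _ :=
  extMap_injective (tHom_ext (tHom_tGen _))

theorem extSecHom_add {M : ScalarExtension F F' A} {X : A} (x y : (extPsh M).sec X) :
    extSecHom ht (x + y) = extSecHom ht x + extSecHom ht y := by
  refine extMap_injective (tHom_ext ?_)
  refine (tHom_tGen _).trans ?_
  exact (congrArg₂ (· + ·) (tHom_tGen x) (tHom_tGen y)).symm

theorem extSecHom_smul {M : ScalarExtension F F' A} {X : A} (a : F') (x : (extPsh M).sec X) :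
    extSecHom ht (a • x) = a • extSecHom ht x := by
  refine extMap_injective (tHom_ext ?_)
  refine (tHom_tGen _).trans ?_
  exact (congrArg (a • ·) (tHom_tGen x)).symm

/-- The family of morphisms attached to an extension `(V', α)` of `V`: a section `x` of `M` over
`Z` goes to the composition of `α` with `V'` of the corresponding morphism `F' ⊗ Z ⟶ M`. -/
def extensionFamily (M : ScalarExtension F F' A) : Hom (extPsh M) (homPsh hV (V'.obj M)) where
  app Z :=
    { toFun := fun x => homSec hV (α.hom.app Z ≫ V'.map (extSecHom ht x))
      map_add' := fun x y => by
        rw [extSecHom_add, hV'.map_add]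
        exact Preadditive.comp_add _ _ _ _ _ _
      map_smul' := fun a x => by
        rw [extSecHom_smul, hV'.map_smul]
        exact Linear.comp_smul _ _ _ _ _ _ }
  naturality {Z' Z} f x := by
    change α.hom.app Z' ≫ V'.map (extSecHom ht ((extPsh M).res f x))
      = V.map f ≫ α.hom.app Z ≫ V'.map (extSecHom ht x)
    rw [extSecHom_res, Functor.map_comp, ← Category.assoc, ← Category.assoc]
    exact congrArg (· ≫ _) (α.hom.naturality f).symm

theorem secToHom_extensionFamily {M : ScalarExtension F F' A} {Z : A} (x : (extPsh M).sec Z) :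
    secToHom hV ((extensionFamily hV hV' α M).app Z x)
      = α.hom.app Z ≫ V'.map (extSecHom ht x) := rfl

theorem extensionFamily_naturality {M N : ScalarExtension F F' A} (f : M ⟶ N) :
    (extensionFamily hV hV' α M).comp (homPshMap hV (V'.map f))
      = (extMap f).comp (extensionFamily hV hV' α N) := by
  refine Hom.ext' fun Z x => ?_
  change (α.hom.app Z ≫ V'.map (extSecHom ht x)) ≫ V'.map f
    = α.hom.app Z ≫ V'.map (extSecHom ht ((extMap f).app Z x))
  rw [extSecHom_extMap, Functor.map_comp, Category.assoc]

theorem extensionFamily_tGen (X : A) :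
    secToHom hV ((extensionFamily hV hV' α ((scalarExtensionFunctor ht).obj X)).app X
      (tGen F F' X)) = α.hom.app X := by
  refine (congrArg (fun f => α.hom.app X ≫ V'.map f) (extSecHom_tGen X)).trans ?_
  rw [V'.map_id]
  exact Category.comp_id _

/-- The presentation `F' ⊗ X₁ ⟶ F' ⊗ X₀ ⟶ M ⟶ 0` given by a generating section and a generator of
the kernel is a cokernel diagram in the scalar extension. -/
theorem exists_isColimit_cokernelCofork {M : ScalarExtension F F' A} {X₀ X₁ : A}
    {x : (extPsh M).sec X₀} {y : (tPsh F F' X₀).sec X₁}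
    (hx : (tHom x : Hom (tPsh F F' X₀) (extPsh M)).LocallySurjective)
    (hy : ClosedSub.span y = ClosedSub.ker M.obj.isLeftExact_psh.separated (tHom x)) :
    ∃ w : extSecHom ht (M := (scalarExtensionFunctor ht).obj X₀) y ≫ extSecHom ht x = 0,
      Nonempty (IsColimit (CokernelCofork.ofπ (extSecHom ht x) w)) := by
  have w : extSecHom ht (M := (scalarExtensionFunctor ht).obj X₀) y ≫ extSecHom ht x = 0 := by
    refine extMap_injective (tHom_ext ?_)
    refine (congrArg ((tHom x).app X₁) (tHom_tGen y)).trans ?_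
    refine (ClosedSub.mem_ker M.obj.isLeftExact_psh.separated (tHom x) y).1 ?_
    rw [← hy]
    exact ClosedSub.mem_span y
  have hdesc : ∀ {N : ScalarExtension F F' A} (g : (scalarExtensionFunctor ht).obj X₀ ⟶ N),
      extSecHom ht (M := (scalarExtensionFunctor ht).obj X₀) y ≫ g = 0 →
        ∃ h : M ⟶ N, extSecHom ht x ≫ h = g := by
    intro N g hg
    have hgy : (extMap g).app X₁ y = 0 := by
      have := congrArg (fun f => (extMap f).app X₁ (tGen F F' X₁)) hg
      exact (congrArg ((extMap g).app X₁) (tHom_tGen y)).symm.trans this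
    obtain ⟨h, hh⟩ := exists_desc N.obj.isLeftExact_psh (tHom x) hx (extMap g)
      (app_eq_zero_of_span_eq_ker N.obj.isLeftExact_psh.separated hy hgy)
    exact ⟨extHomMk h, extMap_injective hh⟩
  refine ⟨w, ⟨CokernelCofork.IsColimit.ofπ _ _ (fun g hg => (hdesc g hg).choose)
    (fun g hg => (hdesc g hg).choose_spec) fun g hg m hm => ?_⟩⟩
  refine extMap_injective (IsSeparated.hom_ext ?_ hx fun Z z => ?_)
  · exact (FieldModule.isLeftExact_psh _).separated
  · exact congrArg (fun f => (extMap f).app Z z) (hm.trans (hdesc g hg).choose_spec.symm)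

/-- The family attached to a right exact extension of `V` is universal. -/
theorem isUniversal_extensionFamily (hA : IsFiniteOver F A) [PreservesFiniteColimits V]
    [PreservesFiniteColimits V'] (M : ScalarExtension F F' A) :
    IsUniversal hV (extensionFamily hV hV' α M) := by
  obtain ⟨X₀, X₁, x, y, hx, hy⟩ := exists_tPsh_presentation hA (hasChainConditions_extPsh hA M)
    M.obj.isLeftExact_psh.separated
  obtain ⟨w, ⟨hc⟩⟩ := exists_isColimit_cokernelCofork (ht := ht) hx hy
  have := hV'.additive
  have hc' := CokernelCofork.mapIsColimit _ hc V'
  have hy₀ : (tHom x).app X₁ y = 0 := by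
    rw [← ClosedSub.mem_ker M.obj.isLeftExact_psh.separated, ← hy]
    exact ClosedSub.mem_span y
  have hepi : Epi (V'.map (extSecHom ht x)) := ⟨fun g h hgh => Cofork.IsColimit.hom_ext hc' hgh⟩
  refine isUniversal_of_presentation hx hy₀ _ ?_ fun b g hg => ?_
  · rw [secToHom_extensionFamily]
    exact epi_comp _ _
  -- under `α`, the section of `Z ↦ Hom(V Z, b)` given by `g` and `y` becomes `V' y ≫ α⁻¹ ≫ g`
  have h₁ : (extensionFamily hV hV' α ((scalarExtensionFunctor ht).obj X₀)).comp
      (homPshMap hV (α.inv.app X₀ ≫ g)) = tHom (homSec hV g) := by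
    refine tHom_ext (Eq.trans ?_ (tHom_tGen _).symm)
    refine (congrArg (· ≫ α.inv.app X₀ ≫ g) (extensionFamily_tGen hV hV' α X₀)).trans ?_
    exact α.hom_inv_id_app_assoc X₀ g
  have h₂ : V'.map (extSecHom ht (M := (scalarExtensionFunctor ht).obj X₀) y)
      ≫ α.inv.app X₀ ≫ g = 0 := by
    rw [← h₁] at hg
    have h₃ : α.hom.app X₁ ≫ V'.map (extSecHom ht (M := (scalarExtensionFunctor ht).obj X₀) y)
        ≫ α.inv.app X₀ ≫ g = 0 := (Category.assoc _ _ _).symm.trans hg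
    exact zero_of_epi_comp _ h₃
  have h₄ : V'.map (extSecHom ht x) ≫ hc'.desc (CokernelCofork.ofπ (α.inv.app X₀ ≫ g) h₂)
      = α.inv.app X₀ ≫ g := hc'.fac _ WalkingParallelPair.one
  exact ⟨_, (Category.assoc _ _ _).trans ((congrArg (α.hom.app X₀ ≫ ·) h₄).trans
    (α.hom_inv_id_app_assoc X₀ g))⟩

/-- The universal family attached to a right exact extension of `V`. -/
def universalFamily (hA : IsFiniteOver F A) [PreservesFiniteColimits V]
    [PreservesFiniteColimits V'] : UniversalFamily hV V' where
  app := extensionFamily hV hV' α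
  naturality := extensionFamily_naturality hV hV' α
  isUniversal := isUniversal_extensionFamily hV hV' α hA

variable {hV}

/-- The values at an object of two functors with universal families are isomorphic. -/
def UniversalFamily.objIso {V₁ V₂ : ScalarExtension F F' A ⥤ B} (u₁ : UniversalFamily hV V₁)
    (u₂ : UniversalFamily hV V₂) (M : ScalarExtension F F' A) : V₁.obj M ≅ V₂.obj M where
  hom := (u₁.isUniversal M).desc (u₂.app M)
  inv := (u₂.isUniversal M).desc (u₁.app M)
  hom_inv_id := (u₁.isUniversal M).hom_ext (by
    rw [comp_homPshMap_comp, IsUniversal.fac, IsUniversal.fac, comp_homPshMap_id])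
  inv_hom_id := (u₂.isUniversal M).hom_ext (by
    rw [comp_homPshMap_comp, IsUniversal.fac, IsUniversal.fac, comp_homPshMap_id])

theorem UniversalFamily.comp_objIso {V₁ V₂ : ScalarExtension F F' A ⥤ B}
    (u₁ : UniversalFamily hV V₁) (u₂ : UniversalFamily hV V₂) (M : ScalarExtension F F' A) :
    (u₁.app M).comp (homPshMap hV (u₁.objIso u₂ M).hom) = u₂.app M :=
  (u₁.isUniversal M).fac _

/-- Two functors with universal families are isomorphic. -/
def UniversalFamily.uniqueIso {V₁ V₂ : ScalarExtension F F' A ⥤ B} (u₁ : UniversalFamily hV V₁)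
    (u₂ : UniversalFamily hV V₂) : V₁ ≅ V₂ :=
  NatIso.ofComponents (u₁.objIso u₂) fun {M N} f => (u₁.isUniversal M).hom_ext (by
    rw [comp_homPshMap_comp, u₁.naturality, comp_homPshMap_comp, comp_objIso, u₂.naturality]
    exact congrArg (Hom.comp (extMap f)) (u₁.comp_objIso u₂ N))

theorem UniversalFamily.comp_uniqueIso {V₁ V₂ : ScalarExtension F F' A ⥤ B}
    (u₁ : UniversalFamily hV V₁) (u₂ : UniversalFamily hV V₂) (M : ScalarExtension F F' A) :
    (u₁.app M).comp (homPshMap hV ((u₁.uniqueIso u₂).hom.app M)) = u₂.app M :=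
  u₁.comp_objIso u₂ M

/-- An isomorphism between two extensions of `V` is compatible with the isomorphisms on `A` if and
only if it is compatible with the attached universal families. -/
theorem extensionFamily_compatible_iff {V₁ V₂ : ScalarExtension F F' A ⥤ B}
    (h₁ : IsLinearFunctor F' F' V₁) (h₂ : IsLinearFunctor F' F' V₂)
    (α₁ : V ≅ scalarExtensionFunctor ht ⋙ V₁) (α₂ : V ≅ scalarExtensionFunctor ht ⋙ V₂)
    (β : V₁ ⟶ V₂) :
    (∀ X : A, α₂.hom.app X = α₁.hom.app X ≫ β.app ((scalarExtensionFunctor ht).obj X)) ↔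
      ∀ M, (extensionFamily hV h₁ α₁ M).comp (homPshMap hV (β.app M))
        = extensionFamily hV h₂ α₂ M := by
  constructor
  · intro hβ M
    refine LinPresheaf.Hom.ext' fun Z x => ?_
    change (α₁.hom.app Z ≫ V₁.map (extSecHom ht x)) ≫ β.app M
      = α₂.hom.app Z ≫ V₂.map (extSecHom ht x)
    rw [hβ]
    refine (Category.assoc _ _ _).trans (Eq.trans ?_ (Category.assoc _ _ _).symm)
    rw [β.naturality]
  · intro h X
    have h' := congrArg (fun φ : Hom (tPsh F F' X) _ => φ.app X (tGen F F' X))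
      (h ((scalarExtensionFunctor ht).obj X))
    refine (extensionFamily_tGen hV h₂ α₂ X).symm.trans (h'.symm.trans ?_)
    exact congrArg (· ≫ β.app ((scalarExtensionFunctor ht).obj X))
      (extensionFamily_tGen hV h₁ α₁ X)

end Uniqueness

end ScalarExt

end

theorem mainTheorem1
    {F : Type u₀} [Field F] {F' : Type v} [Field F'] [Algebra F F']
    {A : Type u} [Category.{v} A] [Abelian A] [Linear F A] (hA : ScalarExt.IsFiniteOver F A)
    {B : Type u₁} [Category.{v₁} B] [Abelian B] [Linear F' B]
    (V : A ⥤ B) (hVlin : ScalarExt.IsLinearFunctor F F' V) (hVex : PreservesFiniteColimits V) :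
    ∃ ht : ∀ X : A, ScalarExt.HasFiniteLength _ ((ScalarExt.tInd F F' A).obj X),
      (∃ V' : ScalarExt.ScalarExtension F F' A ⥤ B,
        ScalarExt.IsLinearFunctor F' F' V' ∧ PreservesFiniteColimits V' ∧
          Nonempty (V ≅ ScalarExt.scalarExtensionFunctor ht ⋙ V')) ∧
      (∀ (V₁' V₂' : ScalarExt.ScalarExtension F F' A ⥤ B),
        ScalarExt.IsLinearFunctor F' F' V₁' → PreservesFiniteColimits V₁' →
        ScalarExt.IsLinearFunctor F' F' V₂' → PreservesFiniteColimits V₂' →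
        ∀ (α₁ : V ≅ ScalarExt.scalarExtensionFunctor ht ⋙ V₁')
          (α₂ : V ≅ ScalarExt.scalarExtensionFunctor ht ⋙ V₂'),
          ∃! β' : V₁' ≅ V₂', ∀ X : A, α₂.hom.app X =
            α₁.hom.app X ≫ β'.hom.app ((ScalarExt.scalarExtensionFunctor ht).obj X)) := by
  refine ⟨ScalarExt.hasFiniteLength_tInd hA, ?_, ?_⟩
  · obtain ⟨V', ⟨u⟩⟩ := ScalarExt.exists_universalFamily hVlin hA
    exact ⟨V', u.isLinearFunctor, u.preservesFiniteColimits hA, ⟨u.iso _⟩⟩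
  · intro V₁ V₂ h₁ _ h₂ _ α₁ α₂
    let u₁ := ScalarExt.universalFamily hVlin h₁ α₁ hA
    let u₂ := ScalarExt.universalFamily hVlin h₂ α₂ hA
    refine ⟨u₁.uniqueIso u₂, ?_, fun β hβ => ?_⟩
    · exact (ScalarExt.extensionFamily_compatible_iff h₁ h₂ α₁ α₂ _).2 (u₁.comp_uniqueIso u₂)
    · refine Iso.ext (NatTrans.ext (funext fun M => (u₁.isUniversal M).hom_ext ?_))
      rw [u₁.comp_uniqueIso u₂]
      exact (ScalarExt.extensionFamily_compatible_iff h₁ h₂ α₁ α₂ β.hom).1 hβ M
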